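/- Let $(M^{n+1},g)$ and $(N^n,h)$ be smooth Riemannian manifolds and let $\varphi:(M^{n+1},g)\to(N^n,h)$ be a Riemannian submersion, i.e. a smooth map such that for every $p\in M$ the differential ${\rm d}\varphi_p$ is onto and restricts to an isometry from the horizontal space $\mathcal H_p=(\ker {\rm d}\varphi_p)^{\perp}$ onto $T_{\varphi(p)}N$. Let $U\subseteq M$ be open and let $\{e_1,\ldots,e_{n+1}\}$ be a smooth orthonormal frame on $U$ adapted to $\varphi$: $e_1,\dots,e_n$ are horizontal and $\varphi$-related to a smooth orthonormal frame $\{\varepsilon_1,\ldots,\varepsilon_n\}$ on $\varphi(U)$, and $e_{n+1}$ is vertical. Then there are smooth functions $F^k_{ij}$ on $\varphi(U)$ and $\kappa_i,\sigma_{ij}$ on $U$ $(1\le i,j,k\le n)$ such that, with $f^k_{ij}=F^k_{ij}\circ\varphi$, $$[\varepsilon_i,\varepsilon_j]=\sum_k F^k_{ij}\,\varepsilon_k \ \text{ on }\varphi(U),\qquad [e_i,e_{n+1}]=\kappa_i\,e_{n+1},\qquad [e_i,e_j]=\sum_k f^k_{ij}\,e_k-2\sigma_{ij}\,e_{n+1}\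 \text{ on }U .$$ For any such functions (the integrability data $\{f^k_{ij},\kappa_i,\sigma_{ij}\}$ of the adapted frame) the following hold. (1) If $f^k_{ij}\equiv 0$ on $U$ for all $i,j,k$, then $\varphi(U)$ is locally flat: every point of $\varphi(U)$ has an open neighbourhood in $\varphi(U)$ that is isometric to an open subset of Euclidean space $\mathbb R^n$. (2) $\sigma_{ij}\equiv 0$ on $U$ for all $i,j$ if and only if the horizontal distribution $\mathcal H$ on $U$ is integrable, i.e. through every point of $U$ there passes an $n$-dimensional immersed submanifold of $U$ whose tangent spaces are the horizontal spaces. (3) $\kappa_i\equiv 0$ on $U$ for all $i$ if and only if $\varphi$ is harmonic on $U$, i.e. its tension field $\tau(\varphi)={\rm Trace}_g\nabla{\rm d}\varphi$ vanishes identically on $U$. -/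

import Mathlib

open Bundle
open scoped Manifold ContDiff

attribute [-instance] TopCat.of.chartedSpace TopCat.of.hasGroupoid

noncomputable section

namespace RiemSubm

/-! ### Coordinate expressions on a Riemannian manifold

A Riemannian manifold of dimension `m` is a smooth manifold modelled on `𝓡 m` whose tangent bundle
carries a smooth Riemannian metric. -/

section Coordinates

variable {m : ℕ} {M : Type*} [TopologicalSpace M] [ChartedSpace (EuclideanSpace ℝ (Fin m)) M]

/-- The coordinate vector field `∂_i` of the chart around `p`, at the point with coordinates `y`. -/
def coordVec (p : M) (i : Fin m) (y : EuclideanSpace ℝ (Fin m)) :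
    TangentSpace (𝓡 m) ((extChartAt (𝓡 m) p).symm y) :=
  mfderiv (𝓡 m) (𝓡 m) (extChartAt (𝓡 m) p).symm y (EuclideanSpace.single i (1 : ℝ))

/-- The partial derivative `∂_i u` at `y` of a function `u` of the coordinates. -/
def partialDeriv (i : Fin m) (u : EuclideanSpace ℝ (Fin m) → ℝ) (y : EuclideanSpace ℝ (Fin m)) :
    ℝ :=
  fderiv ℝ u y (EuclideanSpace.single i (1 : ℝ))

variable [RiemannianBundle (fun x : M ↦ TangentSpace (𝓡 m) x)]

/-- The matrix `g_{ij} = g(∂_i, ∂_j)` of the metric in the chart around `p`, as a function of the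
coordinates. -/
def metricMatrix (p : M) (y : EuclideanSpace ℝ (Fin m)) : Matrix (Fin m) (Fin m) ℝ :=
  Matrix.of fun i j ↦ inner ℝ (coordVec p i y) (coordVec p j y)

/-- The Christoffel symbols `Γ^k_{ij} = ½ g^{kl} (∂_i g_{jl} + ∂_j g_{il} - ∂_l g_{ij})` of the
Levi-Civita connection in the chart around `p`, as functions of the coordinates. -/
def christoffel (p : M) (k i j : Fin m) (y : EuclideanSpace ℝ (Fin m)) : ℝ :=
  (1 / 2 : ℝ) * ∑ l, (metricMatrix p y)⁻¹ k l *
    (partialDeriv i (fun z ↦ metricMatrix p z j l) y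
      + partialDeriv j (fun z ↦ metricMatrix p z i l) y
      - partialDeriv l (fun z ↦ metricMatrix p z i j) y)

end Coordinates

/-! ### Tension field and harmonic maps -/

section Maps

variable {m n : ℕ}
  {M : Type*} [TopologicalSpace M] [ChartedSpace (EuclideanSpace ℝ (Fin m)) M]
  [RiemannianBundle (fun x : M ↦ TangentSpace (𝓡 m) x)]
  {N : Type*} [TopologicalSpace N] [ChartedSpace (EuclideanSpace ℝ (Fin n)) N]
  [RiemannianBundle (fun x : N ↦ TangentSpace (𝓡 n) x)]

/-- The component `φ^c` of `φ` in the charts around `p` and `φ p`. -/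
def coordMap (φ : M → N) (p : M) (c : Fin n) (y : EuclideanSpace ℝ (Fin m)) : ℝ :=
  (writtenInExtChartAt (𝓡 m) (𝓡 n) p φ y : EuclideanSpace ℝ (Fin n)) c

/-- The components at `p` of the second fundamental form `∇dφ`, in the charts around `p` and `φ p`:
`(∇dφ)^c_{ij} = ∂_i ∂_j φ^c - Γ^k_{ij} ∂_k φ^c + Γ^c_{ab} ∂_i φ^a ∂_j φ^b`. -/
def secondFundForm (φ : M → N) (p : M) (c : Fin n) (i j : Fin m) : ℝ :=
  let y := extChartAt (𝓡 m) p p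
  let y' := extChartAt (𝓡 n) (φ p) (φ p)
  partialDeriv i (partialDeriv j (coordMap φ p c)) y
    - ∑ k, christoffel p k i j y * partialDeriv k (coordMap φ p c) y
    + ∑ a, ∑ b, christoffel (φ p) c a b y' *
        partialDeriv i (coordMap φ p a) y * partialDeriv j (coordMap φ p b) y

variable (m n)

/-- The tension field `τ(φ) = Trace_g ∇dφ` at `p`, with components `g^{ij} (∇dφ)^c_{ij}`. Mathlib's
tangent space at `φ p` is the model space, through the chart around `φ p`; so a tangent vector at
`φ p` is the vector of its components in that chart. -/
def tensionField (φ : M → N) (p : M) : TangentSpace (𝓡 n) (φ p) :=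
  (WithLp.toLp 2 fun c ↦ ∑ i, ∑ j,
    (metricMatrix p (extChartAt (𝓡 m) p p))⁻¹ i j * secondFundForm φ p c i j :
      EuclideanSpace ℝ (Fin n))

/-- `φ` is harmonic on `U`: its tension field vanishes identically there. -/
def IsHarmonicOn (φ : M → N) (U : Set M) : Prop :=
  ∀ p ∈ U, tensionField m n φ p = 0

/-! ### Riemannian submersions -/

/-- The vertical space `ker dφ_p`. -/
def verticalSpace (φ : M → N) (p : M) : Submodule ℝ (TangentSpace (𝓡 m) p) :=
  LinearMap.ker (mfderiv (𝓡 m) (𝓡 n) φ p).toLinearMap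

/-- The horizontal space `(ker dφ_p)^⊥`. -/
def horizontalSpace (φ : M → N) (p : M) : Submodule ℝ (TangentSpace (𝓡 m) p) :=
  (verticalSpace m n φ p)ᗮ

/-- A smooth map is a Riemannian submersion if its differential at every point is onto and is
isometric on the horizontal space. -/
structure IsRiemannianSubmersion (φ : M → N) : Prop where
  smooth : ContMDiff (𝓡 m) (𝓡 n) ∞ φ
  surjective : ∀ p, Function.Surjective (mfderiv (𝓡 m) (𝓡 n) φ p)
  isometric : ∀ p, ∀ X ∈ horizontalSpace m n φ p, ∀ Y ∈ horizontalSpace m n φ p,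
    inner ℝ (mfderiv (𝓡 m) (𝓡 n) φ p X) (mfderiv (𝓡 m) (𝓡 n) φ p Y) = inner ℝ X Y

end Maps

/-! ### Flatness and integrable distributions -/

/-- The subset `V` of the Riemannian manifold `N` is locally flat: each of its points has an open
neighbourhood inside `V` that is isometric to an open subset of Euclidean space. -/
def IsLocallyFlatOn (n : ℕ) {N : Type*} [TopologicalSpace N]
    [ChartedSpace (EuclideanSpace ℝ (Fin n)) N]
    [RiemannianBundle (fun x : N ↦ TangentSpace (𝓡 n) x)] (V : Set N) : Prop :=
  ∀ q ∈ V, ∃ ψ : PartialDiffeomorph (𝓡 n) (𝓡 n) N (EuclideanSpace ℝ (Fin n)) ∞,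
    q ∈ ψ.source ∧ ψ.source ⊆ V ∧
    ∀ x ∈ ψ.source, ∀ u v : TangentSpace (𝓡 n) x,
      inner ℝ (mfderiv (𝓡 n) (𝓡 n) ψ x u : EuclideanSpace ℝ (Fin n))
        (mfderiv (𝓡 n) (𝓡 n) ψ x v : EuclideanSpace ℝ (Fin n)) = inner ℝ u v

/-- The distribution `D` of rank `k` is integrable on `U`: through every point `p` of `U` there
passes an integral manifold of `D` inside `U`, that is, the image of a smooth immersion `ψ` of a
neighbourhood `W` of `0` in `ℝ^k` whose tangent spaces are the spaces of `D`. -/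
def IsIntegrableOn {m : ℕ} {M : Type*} [TopologicalSpace M]
    [ChartedSpace (EuclideanSpace ℝ (Fin m)) M] (k : ℕ)
    (D : (p : M) → Submodule ℝ (TangentSpace (𝓡 m) p)) (U : Set M) : Prop :=
  ∀ p ∈ U, ∃ (W : Set (EuclideanSpace ℝ (Fin k))) (ψ : EuclideanSpace ℝ (Fin k) → M),
    IsOpen W ∧ 0 ∈ W ∧ ψ 0 = p ∧ Set.MapsTo ψ W U ∧ ContMDiffOn (𝓡 k) (𝓡 m) ∞ ψ W ∧
    ∀ w ∈ W, Function.Injective (mfderiv (𝓡 k) (𝓡 m) ψ w) ∧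
      LinearMap.range (mfderiv (𝓡 k) (𝓡 m) ψ w).toLinearMap = D (ψ w)

/-! ### Adapted frames and integrability data -/

section Frames

variable {n : ℕ}
  {M : Type*} [TopologicalSpace M] [ChartedSpace (EuclideanSpace ℝ (Fin (n + 1))) M]
  [IsManifold (𝓡 (n + 1)) ∞ M]
  [RiemannianBundle (fun x : M ↦ TangentSpace (𝓡 (n + 1)) x)]
  {N : Type*} [TopologicalSpace N] [ChartedSpace (EuclideanSpace ℝ (Fin n)) N]
  [IsManifold (𝓡 n) ∞ N]
  [RiemannianBundle (fun x : N ↦ TangentSpace (𝓡 n) x)]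

/-- `e_1, …, e_{n+1}` is a smooth orthonormal frame on `U` that is adapted to `φ`: the first `n`
fields are horizontal and `φ`-related to the smooth orthonormal frame `ε_1, …, ε_n` on `φ(U)`, and
the last one is vertical. -/
structure IsAdaptedFrame (φ : M → N) (U : Set M)
    (e : Fin (n + 1) → (x : M) → TangentSpace (𝓡 (n + 1)) x)
    (ε : Fin n → (y : N) → TangentSpace (𝓡 n) y) : Prop where
  smooth : ∀ a, ContMDiffOn (𝓡 (n + 1)) (𝓡 (n + 1)).tangent ∞
    (fun x ↦ (⟨x, e a x⟩ : TangentBundle (𝓡 (n + 1)) M)) U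
  orthonormal : ∀ x ∈ U, Orthonormal ℝ fun a ↦ e a x
  smooth_base : ∀ i, ContMDiffOn (𝓡 n) (𝓡 n).tangent ∞
    (fun y ↦ (⟨y, ε i y⟩ : TangentBundle (𝓡 n) N)) (φ '' U)
  orthonormal_base : ∀ y ∈ φ '' U, Orthonormal ℝ fun i ↦ ε i y
  horizontal : ∀ i : Fin n, ∀ x ∈ U, e i.castSucc x ∈ horizontalSpace (n + 1) n φ x
  related : ∀ i : Fin n, ∀ x ∈ U, mfderiv (𝓡 (n + 1)) (𝓡 n) φ x (e i.castSucc x) = ε i (φ x)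
  vertical : ∀ x ∈ U, e (Fin.last n) x ∈ verticalSpace (n + 1) n φ x

open VectorField in
/-- `f i j k = f^k_{ij}`, `κ i`, `σ i j` are the integrability data on `U` of the adapted frame
`e` over `ε`: `f^k_{ij} = F^k_{ij} ∘ φ` with `[ε_i, ε_j] = F^k_{ij} ε_k` on `φ(U)`, and
`[e_i, e_{n+1}] = κ_i e_{n+1}`, `[e_i, e_j] = f^k_{ij} e_k - 2 σ_{ij} e_{n+1}` on `U`. -/
structure IsIntegrabilityData (φ : M → N) (U : Set M)
    (e : Fin (n + 1) → (x : M) → TangentSpace (𝓡 (n + 1)) x)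
    (ε : Fin n → (y : N) → TangentSpace (𝓡 n) y)
    (f : Fin n → Fin n → Fin n → M → ℝ) (κ : Fin n → M → ℝ) (σ : Fin n → Fin n → M → ℝ) :
    Prop where
  base : ∃ F : Fin n → Fin n → Fin n → N → ℝ,
    (∀ i j k, ContMDiffOn (𝓡 n) 𝓘(ℝ) ∞ (F i j k) (φ '' U)) ∧
    (∀ i j, ∀ y ∈ φ '' U, mlieBracket (𝓡 n) (ε i) (ε j) y = ∑ k, F i j k y • ε k y) ∧
    ∀ i j k, ∀ x ∈ U, f i j k x = F i j k (φ x)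
  smooth_κ : ∀ i, ContMDiffOn (𝓡 (n + 1)) 𝓘(ℝ) ∞ (κ i) U
  smooth_σ : ∀ i j, ContMDiffOn (𝓡 (n + 1)) 𝓘(ℝ) ∞ (σ i j) U
  bracket_vertical : ∀ i : Fin n, ∀ x ∈ U,
    mlieBracket (𝓡 (n + 1)) (e i.castSucc) (e (Fin.last n)) x = κ i x • e (Fin.last n) x
  bracket_horizontal : ∀ i j : Fin n, ∀ x ∈ U,
    mlieBracket (𝓡 (n + 1)) (e i.castSucc) (e j.castSucc) x
      = ∑ k : Fin n, f i j k x • e k.castSucc x - (2 * σ i j x) • e (Fin.last n) x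

end Frames

end RiemSubm

end

noncomputable section

namespace RiemSubm

/-! ### Total differential equations -/

section TotalDifferential

open Set Metric Filter Topology ODE
open scoped NNReal

variable {V E : Type*} [NormedAddCommGroup V] [NormedSpace ℝ V]
  [NormedAddCommGroup E] [NormedSpace ℝ E]

/-! In a chart the adapted frame becomes a frame X_1, …, X_{n+1} of a Euclidean domain, with dual
coframe θ_a, and the metric is ∑ θ_a ⊗ θ_a. Brackets of φ-related fields are φ-related, and e_{n+1}
is related to 0. Hence [e_i, e_{n+1}] is vertical, and the horizontal part of [e_i, e_j] is lifted
from [ε_i, ε_j]. This gives the integrability data, whose coefficients are inner products with the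
frames (`exists_integrabilityData`).

Flatness and integrability rest on one Frobenius theorem, for Dψ = B ∘ ψ
(`exists_hasFDerivAt_comp_of_symmetric`): ψ(v) is the value at time 1 of the solution of γ' = B(γ)v,
and under the integrability condition a Gronwall estimate shows that ψ has derivative B ∘ ψ. If all
f vanish, the ε_i commute, so they are coordinate fields (`IsDualFrame.exists_chart`), and a chart
carrying an orthonormal frame to the standard basis is an isometry. For the horizontal distribution,
which is the kernel of θ_{n+1}, one has dθ_{n+1}(e_i, e_j) = -θ_{n+1}([e_i, e_j]) = 2σ_{ij}, so σ =
0 says that dθ_{n+1} vanishes on ker θ_{n+1}. Then `exists_integral_of_fderiv_symm` gives integral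
manifolds; conversely θ_{n+1} pulls back to 0 on an integral manifold, hence so does dθ_{n+1}
(`fderiv_symm_of_integral`).

For harmonicity, the trace of ∇dφ is a sum over the frame. By the Koszul formula
(`IsDualFrame.dual_covariantDeriv`) the covariant derivatives ∇_{e_i} e_i and ∇_{ε_i} ε_i match, so
the horizontal terms vanish. The vertical term is -dφ(∇_{e_{n+1}} e_{n+1}), and therefore τ(φ) = -∑
κ_k ε_k (`dual_tensionField`). -/

theorem norm_sub_sub_fderiv_le_sq {F : Type*} [NormedAddCommGroup F] [NormedSpace ℝ F]
    {B : E → F} {s : Set E} (hs : Convex ℝ s) (hB : ∀ x ∈ s, DifferentiableAt ℝ B x) {L : ℝ≥0}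
    (hL : LipschitzOnWith L (fderiv ℝ B) s) {x y : E} (hx : x ∈ s) (hy : y ∈ s) :
    ‖B y - B x - fderiv ℝ B x (y - x)‖ ≤ L * ‖y - x‖ ^ 2 := by
  have hconv : Convex ℝ (s ∩ closedBall x ‖y - x‖) := hs.inter (convex_closedBall _ _)
  have := hconv.norm_image_sub_le_of_norm_fderiv_le' (f := B) (φ := fderiv ℝ B x)
    (C := L * ‖y - x‖) (fun z hz ↦ hB z hz.1) (fun z hz ↦ ?_)
    (x := x) (y := y) ⟨hx, by simp⟩ ⟨hy, by simp [dist_eq_norm]⟩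
  · calc _ ≤ _ := this
      _ = _ := by ring
  · have h := hL.norm_sub_le hz.1 hx
    refine h.trans ?_
    gcongr
    simpa [dist_eq_norm] using hz.2

/-- Quantitative bounds on the coefficient of a total differential equation near a point. -/
theorem exists_closedBall_bounds {F : Type*} [NormedAddCommGroup F] [NormedSpace ℝ F]
    {B : E → F} {D : Set E} {x₀ : E} (hD : D ∈ 𝓝 x₀) (hB : ContDiffAt ℝ 2 B x₀) :
    ∃ R : ℝ, 0 < R ∧ ∃ K L M : ℝ≥0, closedBall x₀ R ⊆ D ∧
      (∀ x ∈ closedBall x₀ R, DifferentiableAt ℝ B x) ∧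
      (∀ x ∈ closedBall x₀ R, ‖B x‖ ≤ M) ∧
      (∀ x ∈ closedBall x₀ R, ‖fderiv ℝ B x‖ ≤ K) ∧
      LipschitzOnWith K B (closedBall x₀ R) ∧
      LipschitzOnWith L (fderiv ℝ B) (closedBall x₀ R) := by
  obtain ⟨K₁, s, hs, hK₁⟩ := (hB.of_le one_le_two).exists_lipschitzOnWith
  obtain ⟨L, t, ht, hL⟩ := (hB.fderiv_right (m := 1) (by norm_num)).exists_lipschitzOnWith
  have hdiff : ∀ᶠ x in 𝓝 x₀, DifferentiableAt ℝ B x := by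
    filter_upwards [hB.eventually (by simp)] with x hx
    exact hx.differentiableAt (by simp)
  obtain ⟨R, hR, hsub⟩ := Metric.nhds_basis_closedBall.mem_iff.1
    (inter_mem (inter_mem hD hdiff) (inter_mem hs ht))
  have hx₀ : x₀ ∈ closedBall x₀ R := mem_closedBall_self hR.le
  have hLb : LipschitzOnWith L (fderiv ℝ B) (closedBall x₀ R) := hL.mono fun x hx ↦ (hsub hx).2.2
  have hKb : LipschitzOnWith K₁ B (closedBall x₀ R) := hK₁.mono fun x hx ↦ (hsub hx).2.1
  let R' : ℝ≥0 := ⟨R, hR.le⟩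
  refine ⟨R, hR, max K₁ (L * R' + ‖fderiv ℝ B x₀‖₊), L, K₁ * R' + ‖B x₀‖₊,
    fun x hx ↦ (hsub hx).1.1, fun x hx ↦ (hsub hx).1.2, fun x hx ↦ ?_, fun x hx ↦ ?_,
    hKb.weaken (le_max_left _ _), hLb⟩
  · have h1 := hKb.norm_sub_le hx hx₀
    have h2 := norm_le_norm_sub_add (B x) (B x₀)
    have h3 : ‖x - x₀‖ ≤ R := by simpa [dist_eq_norm] using hx
    have h4 : (K₁ : ℝ) * ‖x - x₀‖ ≤ K₁ * R := by gcongr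
    push_cast
    change _ ≤ (K₁ : ℝ) * R + _
    linarith
  · have h1 := hLb.norm_sub_le hx hx₀
    have h2 := norm_le_norm_sub_add (fderiv ℝ B x) (fderiv ℝ B x₀)
    have h3 : ‖x - x₀‖ ≤ R := by simpa [dist_eq_norm] using hx
    have h4 : (L : ℝ) * ‖x - x₀‖ ≤ L * R := by gcongr
    push_cast
    refine le_trans ?_ (le_max_right _ _)
    change _ ≤ (L : ℝ) * R + _
    linarith

/-- The solution of `γ' = B(γ) v` on `[0, 1]` for small `v`. -/
theorem exists_ray_solution [CompleteSpace E] {B : E → V →L[ℝ] E} {x₀ : E} {R : ℝ} (hR : 0 ≤ R)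
    {K M : ℝ≥0} (hM : ∀ x ∈ closedBall x₀ R, ‖B x‖ ≤ M) (hK : LipschitzOnWith K B (closedBall x₀ R))
    {v : V} (hv : M * ‖v‖ ≤ R) :
    ∃ γ : ℝ → E, γ 0 = x₀ ∧ ∀ t ∈ Icc (0 : ℝ) 1, γ t ∈ closedBall x₀ R ∧
      HasDerivWithinAt γ (B (γ t) v) (Icc 0 1) t := by
  let R' : ℝ≥0 := ⟨R, hR⟩
  have hf : IsPicardLindelof (fun _ x ↦ B x v) (tmin := 0) (tmax := 1) ⟨0, by simp⟩ x₀ R' 0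
      (M * ‖v‖₊) (K * ‖v‖₊) := by
    refine IsPicardLindelof.of_time_independent (fun x hx ↦ ?_) ?_ ?_
    · push_cast
      exact (B x).le_of_opNorm_le (hM x hx) v
    · refine LipschitzOnWith.of_dist_le_mul fun x hx y hy ↦ ?_
      rw [dist_eq_norm, dist_eq_norm, ← sub_apply (B x) (B y) v]
      push_cast
      calc ‖(B x - B y) v‖ ≤ ‖B x - B y‖ * ‖v‖ := (B x - B y).le_opNorm v
        _ ≤ (K * ‖x - y‖) * ‖v‖ := by gcongr; exact hK.norm_sub_le hx hy
        _ = _ := by ring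
    · have hv' : M * ‖v‖ ≤ (R' : ℝ) := hv
      simpa using hv'
  -- Using the Picard fixed point itself yields, besides the equation, that the curve stays in the
  -- ball.
  obtain ⟨α, hα⟩ := FunSpace.exists_isFixedPt_next hf (mem_closedBall_self (x := x₀) le_rfl)
  have hmem : ∀ t, α.compProj t ∈ closedBall x₀ R' := fun t ↦
    α.compProj_mem_closedBall hf.mul_max_le
  refine ⟨α.compProj, ?_, fun t ht ↦ ⟨hmem t, ?_⟩⟩
  · have := α.compProj_val (t := ⟨0, by simp⟩)
    rw [this, ← hα, FunSpace.next_apply₀]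
  · refine (hasDerivWithinAt_picard_Icc (left_mem_Icc.2 zero_le_one) hf.continuousOn_uncurry
      α.continuous_compProj.continuousOn (fun t _ ↦ hmem t) x₀ ht).congr_of_mem ?_ ht
    intro t' ht'
    nth_rw 1 [← hα]
    rw [FunSpace.compProj_of_mem ht', FunSpace.next_apply]

/-- If the equation `Dψ = B ∘ ψ` satisfies the integrability condition, its solutions along rays
depend on the direction of the ray as prescribed by `B`, up to a quadratic error. -/
theorem exists_ray_estimate {B : E → V →L[ℝ] E} {x₀ : E} {R : ℝ} {K L M : ℝ≥0}
    (hd : ∀ x ∈ closedBall x₀ R, DifferentiableAt ℝ B x)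
    (hM : ∀ x ∈ closedBall x₀ R, ‖B x‖ ≤ M) (hK' : ∀ x ∈ closedBall x₀ R, ‖fderiv ℝ B x‖ ≤ K)
    (hK : LipschitzOnWith K B (closedBall x₀ R))
    (hL : LipschitzOnWith L (fderiv ℝ B) (closedBall x₀ R))
    (hsymm : ∀ x ∈ closedBall x₀ R, ∀ u v, fderiv ℝ B x (B x u) v = fderiv ℝ B x (B x v) u)
    (r : ℝ) (hr : 0 ≤ r) :
    ∃ C : ℝ, ∀ (v h : V) (γ η : ℝ → E), ‖v‖ ≤ r → ‖v + h‖ ≤ r → γ 0 = x₀ → η 0 = x₀ →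
      (∀ t ∈ Icc (0 : ℝ) 1, γ t ∈ closedBall x₀ R ∧
        HasDerivWithinAt γ (B (γ t) v) (Icc 0 1) t) →
      (∀ t ∈ Icc (0 : ℝ) 1, η t ∈ closedBall x₀ R ∧
        HasDerivWithinAt η (B (η t) (v + h)) (Icc 0 1) t) →
      ‖η 1 - γ 1 - B (γ 1) h‖ ≤ C * ‖h‖ ^ 2 := by
  set C₁ := gronwallBound 0 (K * r) M 1 with hC₁
  have hC₁0 : 0 ≤ C₁ := by
    have := gronwallBound_mono (δ := 0) (ε := M) (K := K * r) le_rfl M.2 (by positivity)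
      (zero_le_one (α := ℝ))
    rwa [gronwallBound_x0] at this
  set C₂ := K * C₁ + L * C₁ ^ 2 * r with hC₂
  refine ⟨gronwallBound 0 (K * r) C₂ 1, fun v h γ η hv hvh hγ0 hη0 hγ hη ↦ ?_⟩
  -- With zero initial error the Gronwall bound is linear in the inhomogeneity; this lets the
  -- constant be chosen independently of h.
  have hscale : ∀ ε c : ℝ, gronwallBound 0 (K * r) (ε * c) 1 = gronwallBound 0 (K * r) ε 1 * c := by
    intro ε c
    unfold gronwallBound
    split_ifs <;> ring
  have hnhds : ∀ t ∈ Ico (0 : ℝ) 1, Icc (0 : ℝ) 1 ∈ 𝓝[≥] t := fun t ht ↦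
    Icc_mem_nhdsGE_of_mem ht
  have hγc : ContinuousOn γ (Icc 0 1) := fun t ht ↦ (hγ t ht).2.continuousWithinAt
  have hηc : ContinuousOn η (Icc 0 1) := fun t ht ↦ (hη t ht).2.continuousWithinAt
  have hγ' : ∀ t ∈ Ico (0 : ℝ) 1, HasDerivWithinAt γ (B (γ t) v) (Ici t) t := fun t ht ↦
    (hγ t (Ico_subset_Icc_self ht)).2.mono_of_mem_nhdsWithin (hnhds t ht)
  have hη' : ∀ t ∈ Ico (0 : ℝ) 1, HasDerivWithinAt η (B (η t) (v + h)) (Ici t) t := fun t ht ↦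
    (hη t (Ico_subset_Icc_self ht)).2.mono_of_mem_nhdsWithin (hnhds t ht)
  -- the two solutions stay close
  have hclose : ∀ t ∈ Icc (0 : ℝ) 1, ‖η t - γ t‖ ≤ C₁ * ‖h‖ := by
    intro t ht
    have key := norm_le_gronwallBound_of_norm_deriv_right_le (f := fun t ↦ η t - γ t)
      (f' := fun t ↦ B (η t) (v + h) - B (γ t) v) (δ := 0) (K := K * r) (ε := M * ‖h‖)
      (hηc.fun_sub hγc) (fun t ht ↦ (hη' t ht).fun_sub (hγ' t ht)) (by simp [hγ0, hη0]) ?_ t ht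
    · refine key.trans ?_
      rw [← hscale, sub_zero]
      exact gronwallBound_mono le_rfl (by positivity) (by positivity) ht.2
    · intro t ht
      have h1 := (hη t (Ico_subset_Icc_self ht)).1
      have h2 := (hγ t (Ico_subset_Icc_self ht)).1
      have e : B (η t) (v + h) - B (γ t) v = (B (η t) - B (γ t)) (v + h) + B (γ t) h := by
        simp only [map_add, sub_apply]; abel
      rw [e]
      refine (norm_add_le _ _).trans (add_le_add ?_ ((B (γ t)).le_of_opNorm_le (hM _ h2) h))
      calc _ ≤ ‖B (η t) - B (γ t)‖ * ‖v + h‖ := (B (η t) - B (γ t)).le_opNorm _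
        _ ≤ (K * ‖η t - γ t‖) * r := by gcongr; exact hK.norm_sub_le h1 h2
        _ = _ := by ring
  -- The expected first variation of the ray in the direction h is t • B(γ t) h; δ is the defect, to
  -- be shown quadratic in h.
  set δ : ℝ → E := fun t ↦ η t - γ t - t • B (γ t) h with hδ
  have hδ' : ∀ t ∈ Icc (0 : ℝ) 1, HasDerivWithinAt δ (B (η t) (v + h) - B (γ t) v -
      (t • fderiv ℝ B (γ t) (B (γ t) v) h + (1 : ℝ) • B (γ t) h)) (Icc 0 1) t := by
    intro t ht
    have hBγ : HasDerivWithinAt (fun t ↦ B (γ t)) (fderiv ℝ B (γ t) (B (γ t) v)) (Icc 0 1) t :=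
      (hd _ (hγ t ht).1).hasFDerivAt.comp_hasDerivWithinAt t (hγ t ht).2
    exact ((hη t ht).2.fun_sub (hγ t ht).2).fun_sub ((hasDerivWithinAt_id t _).fun_smul
      (by simpa using hBγ.clm_apply (hasDerivWithinAt_const t _ h)))
  have key := norm_le_gronwallBound_of_norm_deriv_right_le (f := δ) (δ := 0) (K := K * r)
    (ε := C₂ * ‖h‖ ^ 2) (fun t ht ↦ (hδ' t ht).continuousWithinAt)
    (fun t ht ↦ (hδ' t (Ico_subset_Icc_self ht)).mono_of_mem_nhdsWithin (hnhds t ht))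
    (by simp [hδ, hγ0, hη0]) ?_ 1 (by simp)
  · rw [sub_zero, hscale] at key
    simpa [hδ] using key
  intro t ht'
  have ht := Ico_subset_Icc_self ht'
  have h1 := (hη t ht).1
  have h2 := (hγ t ht).1
  set A := fderiv ℝ B (γ t) with hA
  have hdiff : η t - γ t = t • B (γ t) h + δ t := by simp only [hδ]; abel
  have e : B (η t) (v + h) - B (γ t) v - (t • A (B (γ t) v) h + (1 : ℝ) • B (γ t) h)
      = A (δ t) v + A (η t - γ t) h + (B (η t) - B (γ t) - A (η t - γ t)) (v + h) := by
    -- Here integrability enters: the term t A(Bγ h)v it produces is absorbed into A(δ)v, so that δ'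
    -- is linear in δ up to errors of order ‖h‖².
    rw [hsymm _ h2 v h]
    have e1 : A (δ t) v = A (η t - γ t) v - t • A (B (γ t) h) v := by
      rw [hdiff]; simp
    rw [e1]
    simp only [map_add, sub_apply, one_smul]
    abel
  rw [e]
  have hcl := hclose t ht
  have b1 : ‖A (δ t) v‖ ≤ K * r * ‖δ t‖ := by
    calc ‖A (δ t) v‖ ≤ ‖A‖ * ‖δ t‖ * ‖v‖ := A.le_opNorm₂ _ _
      _ ≤ K * ‖δ t‖ * r := by gcongr; exact hK' _ h2
      _ = _ := by ring
  have b2 : ‖A (η t - γ t) h‖ ≤ K * C₁ * ‖h‖ ^ 2 := by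
    calc ‖A (η t - γ t) h‖ ≤ ‖A‖ * ‖η t - γ t‖ * ‖h‖ := A.le_opNorm₂ _ _
      _ ≤ K * (C₁ * ‖h‖) * ‖h‖ := by gcongr; exact hK' _ h2
      _ = _ := by ring
  have b3 : ‖(B (η t) - B (γ t) - A (η t - γ t)) (v + h)‖ ≤ L * C₁ ^ 2 * r * ‖h‖ ^ 2 := by
    calc _ ≤ ‖B (η t) - B (γ t) - A (η t - γ t)‖ * ‖v + h‖ := ContinuousLinearMap.le_opNorm _ _
      _ ≤ (L * ‖η t - γ t‖ ^ 2) * r := by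
        gcongr
        exact norm_sub_sub_fderiv_le_sq (convex_closedBall _ _) hd hL h2 h1
      _ ≤ (L * (C₁ * ‖h‖) ^ 2) * r := by gcongr
      _ = _ := by ring
  calc _ ≤ ‖A (δ t) v‖ + ‖A (η t - γ t) h‖
        + ‖(B (η t) - B (γ t) - A (η t - γ t)) (v + h)‖ := norm_add₃_le
    _ ≤ K * r * ‖δ t‖ + K * C₁ * ‖h‖ ^ 2 + L * C₁ ^ 2 * r * ‖h‖ ^ 2 := by gcongr
    _ = _ := by rw [hC₂]; ring

/-- A solution of `Dψ = B ∘ ψ` is as smooth as `B`. -/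
theorem contDiffOn_of_hasFDerivAt_comp {B : E → V →L[ℝ] E} {D : Set E} (hB : ContDiffOn ℝ ∞ B D)
    {W : Set V} (hW : IsOpen W) {ψ : V → E} (hmaps : MapsTo ψ W D)
    (hψ : ∀ w ∈ W, HasFDerivAt ψ (B (ψ w)) w) : ContDiffOn ℝ ∞ ψ W := by
  rw [contDiffOn_infty]
  intro k
  induction k with
  | zero =>
    exact contDiffOn_zero.2 fun w hw ↦ (hψ w hw).continuousAt.continuousWithinAt
  | succ k ih =>
    push_cast
    rw [contDiffOn_succ_iff_fderiv_of_isOpen hW]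
    refine ⟨fun w hw ↦ (hψ w hw).differentiableAt.differentiableWithinAt, by simp, ?_⟩
    refine ((hB.of_le (by exact_mod_cast le_top)).comp ih hmaps).congr fun w hw ↦ ?_
    exact (hψ w hw).fderiv

/-- **Frobenius theorem** for total differential equations: if `DB(x)(B(x)u)v` is symmetric in `u`
and `v`, then `Dψ = B ∘ ψ`, `ψ 0 = x₀` has a smooth solution near `0`. -/
theorem exists_hasFDerivAt_comp_of_symmetric [CompleteSpace E] {B : E → V →L[ℝ] E} {D : Set E}
    (hD : IsOpen D) {x₀ : E} (hx₀ : x₀ ∈ D) (hB : ContDiffOn ℝ ∞ B D)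
    (hsymm : ∀ x ∈ D, ∀ u v, fderiv ℝ B x (B x u) v = fderiv ℝ B x (B x v) u) :
    ∃ (W : Set V) (ψ : V → E), IsOpen W ∧ 0 ∈ W ∧ ψ 0 = x₀ ∧ MapsTo ψ W D ∧
      ContDiffOn ℝ ∞ ψ W ∧ ∀ w ∈ W, HasFDerivAt ψ (B (ψ w)) w := by
  have hDx : D ∈ 𝓝 x₀ := hD.mem_nhds hx₀
  obtain ⟨R, hR, K, L, M, hRD, hd, hM, hK', hK, hL⟩ := exists_closedBall_bounds hDx
    ((hB.contDiffAt hDx).of_le (WithTop.coe_le_coe.2 le_top))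
  -- Rays with M‖v‖ ≤ R live up to time 1 inside the ball; the + 1 covers M = 0.
  set r : ℝ := R / (M + 1) with hr
  have hr0 : 0 < r := by positivity
  have hMr : M * r ≤ R := by
    rw [hr, ← mul_div_assoc, div_le_iff₀ (by positivity)]
    nlinarith [M.2]
  have hex : ∀ v : V, ∃ γ : ℝ → E, ‖v‖ ≤ r → γ 0 = x₀ ∧ ∀ t ∈ Icc (0 : ℝ) 1,
      γ t ∈ closedBall x₀ R ∧ HasDerivWithinAt γ (B (γ t) v) (Icc 0 1) t := by
    intro v
    by_cases hv : ‖v‖ ≤ r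
    · obtain ⟨γ, hγ⟩ := exists_ray_solution hR.le hM hK (v := v)
        (le_trans (by gcongr) hMr)
      exact ⟨γ, fun _ ↦ hγ⟩
    · exact ⟨fun _ ↦ x₀, fun h ↦ absurd h hv⟩
  choose Γ hΓ using hex
  obtain ⟨C, hC⟩ := exists_ray_estimate hd hM hK' hK hL (fun x hx ↦ hsymm x (hRD hx)) r hr0.le
  have hmaps : MapsTo (fun v ↦ Γ v 1) (ball (0 : V) r) D := by
    intro v hv
    have hv' : ‖v‖ ≤ r := (mem_ball_zero_iff.1 hv).le
    exact hRD ((hΓ v hv').2 1 (by simp)).1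
  have hψ : ∀ v ∈ ball (0 : V) r, HasFDerivAt (fun v ↦ Γ v 1) (B (Γ v 1)) v := by
    intro v hv
    have hv' : ‖v‖ ≤ r := (mem_ball_zero_iff.1 hv).le
    rw [hasFDerivAt_iff_isLittleO_nhds_zero]
    have hev : ∀ᶠ h in 𝓝 (0 : V), ‖Γ (v + h) 1 - Γ v 1 - B (Γ v 1) h‖ ≤ C * ‖‖h‖ ^ 2‖ := by
      have hc : Tendsto (fun h : V ↦ v + h) (𝓝 0) (𝓝 v) := by
        have := (continuous_const_add v).tendsto (0 : V)
        rwa [add_zero] at this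
      filter_upwards [hc (isOpen_ball.mem_nhds hv)] with h hh
      have hh' : ‖v + h‖ ≤ r := (mem_ball_zero_iff.1 hh).le
      rw [norm_pow, norm_norm]
      exact hC v h _ _ hv' hh' (hΓ v hv').1 (hΓ _ hh').1 (hΓ v hv').2 (hΓ _ hh').2
    refine (Asymptotics.IsBigO.of_bound C hev).trans_isLittleO ?_
    exact Asymptotics.isLittleO_norm_pow_id one_lt_two
  refine ⟨ball 0 r, fun v ↦ Γ v 1, isOpen_ball, mem_ball_self hr0, ?_, hmaps,
    contDiffOn_of_hasFDerivAt_comp hB isOpen_ball hmaps hψ, hψ⟩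
  -- For v = 0 the ray equation is γ' = 0, so the endpoint is still x₀.
  obtain ⟨h0, h1⟩ := hΓ 0 (by simpa using hr0.le)
  rw [← h0]
  refine constant_of_derivWithin_zero (fun t ht ↦ (h1 t ht).2.differentiableWithinAt)
    (fun t ht ↦ ?_) 1 (by simp)
  have ht' := Ico_subset_Icc_self ht
  rw [(h1 t ht').2.derivWithin (uniqueDiffOn_Icc zero_lt_one t ht'), map_zero]

end TotalDifferential

/-! ### Frames and dual coframes in a vector space -/

section DualFrame

open Set Filter Topology VectorField

variable {m : ℕ} {E : Type*} [NormedAddCommGroup E] [NormedSpace ℝ E]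

/-- `θ_1, …, θ_m` is the coframe dual to the smooth frame `X_1, …, X_m` on the open set `D`. -/
structure IsDualFrame (D : Set E) (X : Fin m → E → E) (θ : Fin m → E → E →L[ℝ] ℝ) : Prop where
  isOpen : IsOpen D
  smooth : ∀ a, ContDiffOn ℝ ∞ (X a) D
  smooth_dual : ∀ a, ContDiffOn ℝ ∞ (θ a) D
  dual : ∀ y ∈ D, ∀ a b, θ a y (X b y) = if a = b then 1 else 0
  sum_smul : ∀ y ∈ D, ∀ u, ∑ a, θ a y u • X a y = u

/-- The linear map `ℝ^m → E` with `u ↦ ∑ u_a X_a(y)`. -/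
def frameMap (X : Fin m → E → E) (y : E) : EuclideanSpace ℝ (Fin m) →L[ℝ] E :=
  ∑ a, (EuclideanSpace.proj a : EuclideanSpace ℝ (Fin m) →L[ℝ] ℝ).smulRight (X a y)

theorem frameMap_apply (X : Fin m → E → E) (y : E) (u : EuclideanSpace ℝ (Fin m)) :
    frameMap X y u = ∑ a, u a • X a y := by
  simp [frameMap, sum_apply]

theorem frameMap_single (X : Fin m → E → E) (y : E) (a : Fin m) :
    frameMap X y (EuclideanSpace.single a 1) = X a y := by
  rw [frameMap_apply, Finset.sum_eq_single a] <;> simp +contextual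

theorem contDiffOn_frameMap {X : Fin m → E → E} {D : Set E}
    (hX : ∀ a, ContDiffOn ℝ ∞ (X a) D) : ContDiffOn ℝ ∞ (frameMap X) D :=
  ContDiffOn.sum fun a _ ↦ contDiffOn_const.smulRight (hX a)

theorem fderiv_frameMap_apply {X : Fin m → E → E} {y : E}
    (hX : ∀ a, DifferentiableAt ℝ (X a) y) (w : E) (u : EuclideanSpace ℝ (Fin m)) :
    fderiv ℝ (frameMap X) y w u = ∑ a, u a • fderiv ℝ (X a) y w := by
  have h : HasFDerivAt (fun z ↦ frameMap X z u) (∑ a, u a • fderiv ℝ (X a) y) y := by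
    simp_rw [frameMap_apply]
    exact HasFDerivAt.fun_sum fun a _ ↦ (hX a).hasFDerivAt.const_smul (u a)
  have hd : DifferentiableAt ℝ (frameMap X) y := by
    unfold frameMap
    fun_prop
  have h' := hd.hasFDerivAt.clm_apply (hasFDerivAt_const u y)
  have := congrArg (fun T : E →L[ℝ] E ↦ T w) (h'.unique h)
  simpa [sum_apply] using this

/-- The frame map is injective between spaces of equal dimension, hence invertible. The components
of its inverse are the dual forms, and they are smooth because inversion of operators is smooth. -/
theorem exists_isDualFrame [FiniteDimensional ℝ E] (hm : Module.finrank ℝ E = m) {D : Set E}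
    (hD : IsOpen D) {X : Fin m → E → E} (hX : ∀ a, ContDiffOn ℝ ∞ (X a) D)
    (hli : ∀ y ∈ D, LinearIndependent ℝ fun a ↦ X a y) :
    ∃ θ : Fin m → E → E →L[ℝ] ℝ, IsDualFrame D X θ := by
  have hinv : ∀ y ∈ D, (frameMap X y).IsInvertible := by
    intro y hy
    have hinj : Function.Injective (frameMap X y) := by
      rw [injective_iff_map_eq_zero]
      intro u hu
      rw [frameMap_apply] at hu
      ext a
      exact Fintype.linearIndependent_iff.1 (hli y hy) (fun a ↦ u a) hu a
    have hfr : Module.finrank ℝ (EuclideanSpace ℝ (Fin m)) = Module.finrank ℝ E := by simp [hm]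
    exact ⟨(LinearEquiv.ofInjectiveOfFinrankEq (frameMap X y).toLinearMap hinj
      hfr).toContinuousLinearEquiv, by ext; rfl⟩
  refine ⟨fun a y ↦ (EuclideanSpace.proj a : EuclideanSpace ℝ (Fin m) →L[ℝ] ℝ).comp
    (frameMap X y).inverse, hD, hX, fun a ↦ ?_, fun y hy a b ↦ ?_, fun y hy u ↦ ?_⟩
  · intro y hy
    have h1 : ContDiffWithinAt ℝ ∞ (fun y ↦ (frameMap X y).inverse) D y :=
      (hinv y hy).contDiffAt_map_inverse.comp_contDiffWithinAt y (contDiffOn_frameMap hX y hy)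
    exact contDiffWithinAt_const.clm_comp h1
  · obtain ⟨A, hA⟩ := hinv y hy
    rw [ContinuousLinearMap.comp_apply, ← frameMap_single X y b, ← hA,
      ContinuousLinearMap.inverse_equiv]
    simp [PiLp.single_apply]
  · obtain ⟨A, hA⟩ := hinv y hy
    have : frameMap X y ((frameMap X y).inverse u) = u := by
      rw [← hA, ContinuousLinearMap.inverse_equiv]; simp
    rw [frameMap_apply] at this
    exact this

namespace IsDualFrame

variable {D : Set E} {X : Fin m → E → E} {θ : Fin m → E → E →L[ℝ] ℝ}

theorem differentiableAt (h : IsDualFrame D X θ) {y : E} (hy : y ∈ D) (a : Fin m) :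
    DifferentiableAt ℝ (X a) y :=
  ((h.smooth a).contDiffAt (h.isOpen.mem_nhds hy)).differentiableAt (by simp)

theorem differentiableAt_dual (h : IsDualFrame D X θ) {y : E} (hy : y ∈ D) (a : Fin m) :
    DifferentiableAt ℝ (θ a) y :=
  ((h.smooth_dual a).contDiffAt (h.isOpen.mem_nhds hy)).differentiableAt (by simp)

/-- Two linear maps that agree on a frame are equal. -/
theorem clm_ext (h : IsDualFrame D X θ) {y : E} (hy : y ∈ D) {F : Type*} [NormedAddCommGroup F]
    [NormedSpace ℝ F] {S T : E →L[ℝ] F} (hST : ∀ a, S (X a y) = T (X a y)) : S = T := by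
  ext u
  rw [← h.sum_smul y hy u]
  simp [hST]

theorem eq_of_dual_eq (h : IsDualFrame D X θ) {y : E} (hy : y ∈ D) {u v : E}
    (huv : ∀ a, θ a y u = θ a y v) : u = v := by
  rw [← h.sum_smul y hy u, ← h.sum_smul y hy v]
  simp [huv]

/-- Differentiate the constant function θ_c(X_a). -/
theorem fderiv_dual_apply (h : IsDualFrame D X θ) {y : E} (hy : y ∈ D) (c a : Fin m) (u : E) :
    fderiv ℝ (θ c) y u (X a y) = -θ c y (fderiv ℝ (X a) y u) := by
  have h1 : (fun z ↦ θ c z (X a z)) =ᶠ[𝓝 y] fun _ ↦ if c = a then 1 else 0 := by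
    filter_upwards [h.isOpen.mem_nhds hy] with z hz
    exact h.dual z hz c a
  have h2 := ((h.differentiableAt_dual hy c).hasFDerivAt.clm_apply
    (h.differentiableAt hy a).hasFDerivAt).congr_of_eventuallyEq h1.symm
  have h3 := congrArg (fun T : E →L[ℝ] ℝ ↦ T u) (h2.unique (hasFDerivAt_const _ y))
  simp at h3
  linarith

/-- Cartan's formula dθ(X, Y) = Xθ(Y) - Yθ(X) - θ([X, Y]), where the first two terms vanish because
θ_c is constant on the frame. -/
theorem dual_lieBracket (h : IsDualFrame D X θ) {y : E} (hy : y ∈ D) (c a b : Fin m) :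
    θ c y (lieBracket ℝ (X a) (X b) y) =
      fderiv ℝ (θ c) y (X b y) (X a y) - fderiv ℝ (θ c) y (X a y) (X b y) := by
  rw [h.fderiv_dual_apply hy, h.fderiv_dual_apply hy, lieBracket, map_sub]
  ring

/-- If `θ_c` vanishes on the brackets of the fields `X_a`, `a ≠ c`, then `dθ_c` vanishes on
`ker θ_c`. -/
theorem fderiv_dual_symm (h : IsDualFrame D X θ) {y : E} (hy : y ∈ D) {c : Fin m}
    (hbr : ∀ a b, a ≠ c → b ≠ c → θ c y (lieBracket ℝ (X a) (X b) y) = 0) {u v : E}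
    (hu : θ c y u = 0) (hv : θ c y v = 0) :
    fderiv ℝ (θ c) y u v = fderiv ℝ (θ c) y v u := by
  rw [← h.sum_smul y hy u, ← h.sum_smul y hy v]
  simp only [map_sum, map_smul, sum_apply, smul_apply, Finset.smul_sum]
  rw [Finset.sum_comm]
  refine Finset.sum_congr rfl fun b _ ↦ Finset.sum_congr rfl fun a _ ↦ ?_
  -- Terms involving X_c carry the factor θ_c(v) or θ_c(u), which is zero; for the others the
  -- bracket hypothesis applies.
  by_cases ha : a = c
  · subst ha; simp [hv]
  by_cases hb : b = c
  · subst hb; simp [hu]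
  have := h.dual_lieBracket hy c a b
  rw [hbr a b ha hb] at this
  simp only [smul_eq_mul]
  linear_combination (-(θ a y v * θ b y u)) * this

/-- A frame as a linear isomorphism `ℝ^m ≃ E`. -/
def equiv (h : IsDualFrame D X θ) {y : E} (hy : y ∈ D) : EuclideanSpace ℝ (Fin m) ≃L[ℝ] E :=
  ContinuousLinearEquiv.equivOfInverse (frameMap X y)
    ((PiLp.continuousLinearEquiv 2 ℝ (fun _ : Fin m ↦ ℝ)).symm.toContinuousLinearMap.comp
      (ContinuousLinearMap.pi fun a ↦ θ a y))
    (fun u ↦ by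
      ext a
      simp [frameMap_apply, h.dual y hy])
    (fun u ↦ by
      rw [frameMap_apply]
      exact h.sum_smul y hy u)

/-- A commuting frame is a coordinate frame. -/
theorem exists_chart [CompleteSpace E] (h : IsDualFrame D X θ)
    (hcomm : ∀ y ∈ D, ∀ a b, lieBracket ℝ (X a) (X b) y = 0) {y₀ : E} (hy₀ : y₀ ∈ D) :
    ∃ χ : OpenPartialHomeomorph E (EuclideanSpace ℝ (Fin m)), y₀ ∈ χ.source ∧ χ.source ⊆ D ∧
      ContDiffOn ℝ ∞ χ χ.source ∧ ContDiffOn ℝ ∞ χ.symm χ.target ∧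
      ∀ y ∈ χ.source, ∀ a, fderiv ℝ χ y (X a y) = EuclideanSpace.single a 1 := by
  -- For B the frame map, the integrability condition is exactly DX_b(X_a) = DX_a(X_b), the
  -- vanishing of the brackets.
  obtain ⟨W, ψ, hW, h0, hψ0, hmaps, hψs, hψ⟩ := exists_hasFDerivAt_comp_of_symmetric h.isOpen hy₀
    (contDiffOn_frameMap h.smooth) (fun y hy u v ↦ by
      rw [fderiv_frameMap_apply (h.differentiableAt hy), fderiv_frameMap_apply
        (h.differentiableAt hy), frameMap_apply, frameMap_apply]
      simp only [map_sum, map_smul, Finset.smul_sum]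
      rw [Finset.sum_comm]
      refine Finset.sum_congr rfl fun b _ ↦ Finset.sum_congr rfl fun a _ ↦ ?_
      have := hcomm y hy a b
      rw [lieBracket, sub_eq_zero] at this
      rw [this, smul_comm])
  have hψat : ∀ w ∈ W, ContDiffAt ℝ ∞ ψ w := fun w hw ↦ hψs.contDiffAt (hW.mem_nhds hw)
  have hψe : ∀ w (hw : w ∈ W), HasFDerivAt ψ
      (h.equiv (hmaps hw) : EuclideanSpace ℝ (Fin m) →L[ℝ] E) w := fun w hw ↦ hψ w hw
  -- The inverse function theorem inverts ψ near 0; restricting to W keeps the equation Dψ = B ∘ ψ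
  -- valid on the whole source. The chart sought is the inverse of H.
  set H := ((hψat 0 h0).toOpenPartialHomeomorph ψ (hψe 0 h0) (by simp)).restrOpen W hW with hH
  have hHψ : ∀ w, H w = ψ w := fun w ↦ rfl
  have hsrc : ∀ w ∈ H.source, w ∈ W := fun w hw ↦ hw.2
  have hmemW : ∀ y ∈ H.target, H.symm y ∈ W := fun y hy ↦ hsrc _ (H.map_target hy)
  have hsymm : ∀ y ∈ H.target, ψ (H.symm y) = y := fun y hy ↦ H.right_inv hy
  have hder : ∀ y (hy : y ∈ H.target), HasFDerivAt H.symm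
      ((h.equiv (hmaps (hmemW y hy))).symm : E →L[ℝ] EuclideanSpace ℝ (Fin m)) y :=
    fun y hy ↦ H.hasFDerivAt_symm hy (hψe _ (hmemW y hy))
  have h0src : (0 : EuclideanSpace ℝ (Fin m)) ∈ H.source :=
    ⟨(hψat 0 h0).mem_toOpenPartialHomeomorph_source (hψe 0 h0) (by simp), h0⟩
  refine ⟨H.symm, ?_, fun y hy ↦ ?_, fun y hy ↦ ?_, fun w hw ↦ ?_, fun y hy a ↦ ?_⟩
  · have := H.map_source h0src
    rwa [hHψ, hψ0] at this
  · rw [← hsymm y hy]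
    exact hmaps (hmemW y hy)
  · exact (H.contDiffAt_symm hy (hψe _ (hmemW y hy)) (hψat _ (hmemW y hy))).contDiffWithinAt
  · exact (hψat w (hsrc w hw)).contDiffWithinAt
  · rw [(hder y hy).fderiv]
    change (h.equiv (hmaps (hmemW y hy))).symm (X a y) = _
    rw [ContinuousLinearEquiv.symm_apply_eq]
    have : X a y = frameMap X (ψ (H.symm y)) (EuclideanSpace.single a 1) := by
      rw [frameMap_single, hsymm y hy]
    exact this

end IsDualFrame

end DualFrame

/-! ### Integral manifolds of the kernel of a one-form -/

section KernelDistribution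

open Set Filter Topology

variable {E F : Type*} [NormedAddCommGroup E] [NormedSpace ℝ E] [NormedAddCommGroup F]
  [NormedSpace ℝ F]

/-- The derivative of a one-form is symmetric on the tangent spaces of its integral manifolds. -/
theorem fderiv_symm_of_integral {θ : E → E →L[ℝ] ℝ} {ψ : F → E} {w : F}
    (hψ : ContDiffAt ℝ 2 ψ w) (hθ : DifferentiableAt ℝ θ (ψ w))
    (h : ∀ᶠ z in 𝓝 w, ∀ v, θ (ψ z) (fderiv ℝ ψ z v) = 0) (u v : F) :
    fderiv ℝ θ (ψ w) (fderiv ℝ ψ w u) (fderiv ℝ ψ w v) =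
      fderiv ℝ θ (ψ w) (fderiv ℝ ψ w v) (fderiv ℝ ψ w u) := by
  have hd : DifferentiableAt ℝ (fderiv ℝ ψ) w :=
    (hψ.fderiv_right (m := 1) (by norm_num)).differentiableAt (by simp)
  -- Obtained by differentiating θ(ψ)(Dψ v) = 0 along u; the right-hand side is symmetric since D²ψ
  -- is.
  have key : ∀ u v, fderiv ℝ θ (ψ w) (fderiv ℝ ψ w u) (fderiv ℝ ψ w v)
      = -θ (ψ w) (fderiv ℝ (fderiv ℝ ψ) w u v) := by
    intro u v
    have h1 : HasFDerivAt (fun z ↦ θ (ψ z)) ((fderiv ℝ θ (ψ w)).comp (fderiv ℝ ψ w)) w :=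
      hθ.hasFDerivAt.comp w (hψ.differentiableAt (by simp)).hasFDerivAt
    have h2 := h1.clm_apply (hd.hasFDerivAt.clm_apply (hasFDerivAt_const v w))
    have h3 : (fun z ↦ θ (ψ z) (fderiv ℝ ψ z v)) =ᶠ[𝓝 w] fun _ ↦ 0 := by
      filter_upwards [h] with z hz using hz v
    have h4 := congrArg (fun T : F →L[ℝ] ℝ ↦ T u)
      ((h2.congr_of_eventuallyEq h3.symm).unique (hasFDerivAt_const 0 w))
    simp at h4
    linarith
  rw [key, key, (hψ.isSymmSndFDerivAt (by simp)) u v]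

/-- **Frobenius theorem** in corank one: if `dθ` vanishes on `ker θ`, then `ker θ` is the tangent
distribution of an integral manifold through each point. -/
theorem exists_integral_of_fderiv_symm [CompleteSpace E] {θ : E → E →L[ℝ] ℝ} {D : Set E}
    (hD : IsOpen D) {x₀ : E} (hx₀ : x₀ ∈ D) (hθ : ContDiffOn ℝ ∞ θ D)
    (hsymm : ∀ x ∈ D, ∀ u v, θ x u = 0 → θ x v = 0 → fderiv ℝ θ x u v = fderiv ℝ θ x v u)
    {V : E} (hV : θ x₀ V ≠ 0) {J : F →L[ℝ] E} (hJ : Function.Injective J)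
    (hJθ : ∀ u, θ x₀ (J u) = 0) :
    ∃ (W : Set F) (ψ : F → E), IsOpen W ∧ 0 ∈ W ∧ ψ 0 = x₀ ∧ MapsTo ψ W D ∧
      ContDiffOn ℝ ∞ ψ W ∧
      ∀ w ∈ W, Function.Injective (fderiv ℝ ψ w) ∧ ∀ u, θ (ψ w) (fderiv ℝ ψ w u) = 0 := by
  -- On D' the fixed vector V stays transverse to ker θ.
  set D' := D ∩ (fun x ↦ θ x V) ⁻¹' {0}ᶜ with hD'def
  have hθV : ContDiffOn ℝ ∞ (fun x ↦ θ x V) D := hθ.clm_apply contDiffOn_const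
  have hD' : IsOpen D' := hθV.continuousOn.isOpen_inter_preimage hD isOpen_compl_singleton
  let T : ℝ →L[ℝ] E := ContinuousLinearMap.toSpanSingleton ℝ V
  let c : E → F →L[ℝ] ℝ := fun x ↦ -(θ x V)⁻¹ • (θ x).comp J
  -- B x is J followed by the projection onto ker θ_x along V, so ker θ becomes the range condition
  -- of a total differential equation.
  let B : E → F →L[ℝ] E := fun x ↦ J + T.comp (c x)
  have hc : ContDiffOn ℝ ∞ c D' :=
    (((hθV.mono inter_subset_left).inv fun x hx ↦ hx.2).neg).smul
      ((hθ.mono inter_subset_left).clm_comp contDiffOn_const)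
  have hB : ContDiffOn ℝ ∞ B D' := contDiffOn_const.add (contDiffOn_const.clm_comp hc)
  have hBθ : ∀ x ∈ D', ∀ u, θ x (B x u) = 0 := by
    intro x hx u
    have hne : θ x V ≠ 0 := hx.2
    simp [B, T, c]
    field_simp
    ring
  -- B varies only in the direction V, and the coefficient comes from differentiating θ(B u) = 0.
  -- Thus the integrability condition for B is the symmetry of Dθ on ker θ.
  have hDB : ∀ x ∈ D', ∀ w u, fderiv ℝ B x w u = -((θ x V)⁻¹ * fderiv ℝ θ x w (B x u)) • V := by
    intro x hx w u
    have hne : θ x V ≠ 0 := hx.2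
    have hnhds := hD'.mem_nhds hx
    have hcd : DifferentiableAt ℝ c x := (hc.contDiffAt hnhds).differentiableAt (by simp)
    have hθd : DifferentiableAt ℝ θ x :=
      ((hθ.mono inter_subset_left).contDiffAt hnhds).differentiableAt (by simp)
    have hBd : DifferentiableAt ℝ B x := (hB.contDiffAt hnhds).differentiableAt (by simp)
    have h1 : fderiv ℝ B x w u = fderiv ℝ c x w u • V := by
      have h2 : HasFDerivAt (fun z ↦ B z u)
          (T.comp ((fderiv ℝ c x).flip u)) x := by
        have h3 : HasFDerivAt (fun z ↦ c z u) ((fderiv ℝ c x).flip u) x := by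
          have := hcd.hasFDerivAt.clm_apply (hasFDerivAt_const u x)
          simpa using this
        exact (T.hasFDerivAt.comp x h3).const_add (J u)
      have h4 := hBd.hasFDerivAt.clm_apply (hasFDerivAt_const u x)
      have := congrArg (fun S : E →L[ℝ] E ↦ S w) (h4.unique h2)
      simpa [T] using this
    have h5 : fderiv ℝ θ x w (B x u) + θ x (fderiv ℝ B x w u) = 0 := by
      have h6 := hθd.hasFDerivAt.clm_apply (hBd.hasFDerivAt.clm_apply (hasFDerivAt_const u x))
      have h7 : (fun z ↦ θ z (B z u)) =ᶠ[𝓝 x] fun _ ↦ 0 := by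
        filter_upwards [hnhds] with z hz using hBθ z hz u
      have h8 := congrArg (fun S : E →L[ℝ] ℝ ↦ S w)
        ((h6.congr_of_eventuallyEq h7.symm).unique (hasFDerivAt_const 0 x))
      simp at h8
      linarith
    rw [h1, map_smul, smul_eq_mul] at h5
    rw [h1]
    congr 1
    field_simp
    linarith
  obtain ⟨W, ψ, hW, h0, hψ0, hmaps, hψs, hψ⟩ :=
    exists_hasFDerivAt_comp_of_symmetric hD' (x₀ := x₀) ⟨hx₀, hV⟩ hB (fun x hx u v ↦ by
      rw [hDB x hx, hDB x hx, hsymm x hx.1 _ _ (hBθ x hx u) (hBθ x hx v)])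
  refine ⟨W, ψ, hW, h0, hψ0, hmaps.mono_right inter_subset_left, hψs, fun w hw ↦ ?_⟩
  rw [(hψ w hw).fderiv]
  refine ⟨?_, hBθ _ (hmaps hw)⟩
  rw [injective_iff_map_eq_zero]
  intro u hu
  -- If B u = 0 then J u is a multiple of V; it also lies in ker θ at x₀, which V does not, so it is
  -- 0.
  have e : J u = -(c (ψ w) u) • V := by
    rw [neg_smul]
    exact eq_neg_of_add_eq_zero_left (by simpa [B, T] using hu)
  have hz := hJθ u
  rw [e, map_smul, smul_eq_mul, mul_eq_zero, or_iff_left hV] at hz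
  rw [hz, zero_smul] at e
  exact hJ (by rw [e, map_zero])

end KernelDistribution

/-! ### Christoffel symbols and tension field in an orthonormal frame -/

section Expansion

variable {m : ℕ}

/-- Linearity enters as two plain identities, so that any single slot of a multilinear expression
can be expanded. -/
theorem apply_eq_sum_single {f : EuclideanSpace ℝ (Fin m) → ℝ}
    (hadd : ∀ u v, f (u + v) = f u + f v) (hsmul : ∀ (c : ℝ) u, f (c • u) = c * f u)
    (u : EuclideanSpace ℝ (Fin m)) : f u = ∑ i, u i * f (EuclideanSpace.single i 1) := by
  have hu : u = ∑ i, u i • EuclideanSpace.single i (1 : ℝ) := by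
    ext j
    simp [Pi.single_apply]
  have h := map_sum (IsLinearMap.mk' f ⟨hadd, hsmul⟩) (fun i ↦ u i • EuclideanSpace.single i (1 : ℝ))
    Finset.univ
  rw [← hu] at h
  simpa [hsmul] using h

theorem clm_apply_eq_sum_single {n : ℕ}
    (T : EuclideanSpace ℝ (Fin m) →L[ℝ] EuclideanSpace ℝ (Fin n)) (u : EuclideanSpace ℝ (Fin m))
    (c : Fin n) : T u c = ∑ i, u i * T (EuclideanSpace.single i 1) c :=
  apply_eq_sum_single (f := fun u ↦ T u c) (by simp) (by simp) u

end Expansion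

/-! ### Levi-Civita connection of an orthonormal frame -/

section FrameMetric

open Filter Topology VectorField

variable {m : ℕ} {M : Type*} [TopologicalSpace M] [ChartedSpace (EuclideanSpace ℝ (Fin m)) M]
  [RiemannianBundle (fun x : M ↦ TangentSpace (𝓡 m) x)]

/-- The quadratic form `Γ(u, v) = Γ^k_{ij} u^i v^j` of the Christoffel symbols. -/
def christoffelForm (p : M) (y u v : EuclideanSpace ℝ (Fin m)) : EuclideanSpace ℝ (Fin m) :=
  WithLp.toLp 2 fun k ↦ ∑ i, ∑ j, christoffel p k i j y * u i * v j

/-- The derivative in the direction `w` of the metric `∑ θ_c ⊗ θ_c`, evaluated at `u`, `v`. -/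
def dualMetricDeriv (θ : Fin m → EuclideanSpace ℝ (Fin m) → EuclideanSpace ℝ (Fin m) →L[ℝ] ℝ)
    (y w u v : EuclideanSpace ℝ (Fin m)) : ℝ :=
  ∑ c, (fderiv ℝ (θ c) y w u * θ c y v + θ c y u * fderiv ℝ (θ c) y w v)

/-- Trilinearity, one slot at a time. Christoffel symbols are defined on coordinate vectors, while
the Koszul formula is needed on frame vectors. -/
theorem dualMetricDeriv_eq_sum
    (θ : Fin m → EuclideanSpace ℝ (Fin m) → EuclideanSpace ℝ (Fin m) →L[ℝ] ℝ)
    (y w u v : EuclideanSpace ℝ (Fin m)) :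
    dualMetricDeriv θ y w u v = ∑ i, ∑ j, ∑ l, w i * u j * v l *
      dualMetricDeriv θ y (EuclideanSpace.single i 1) (EuclideanSpace.single j 1)
        (EuclideanSpace.single l 1) := by
  have h1 : ∀ w u v, dualMetricDeriv θ y w u v
      = ∑ i, w i * dualMetricDeriv θ y (EuclideanSpace.single i 1) u v := fun w u v ↦
    apply_eq_sum_single (f := fun w ↦ dualMetricDeriv θ y w u v)
      (fun a b ↦ by
        simp only [dualMetricDeriv, map_add, add_apply, ← Finset.sum_add_distrib]
        exact Finset.sum_congr rfl fun _ _ ↦ by ring)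
      (fun a b ↦ by
        simp only [dualMetricDeriv, map_smul, smul_apply, Finset.mul_sum, smul_eq_mul]
        exact Finset.sum_congr rfl fun _ _ ↦ by ring) w
  have h2 : ∀ w u v, dualMetricDeriv θ y w u v
      = ∑ i, u i * dualMetricDeriv θ y w (EuclideanSpace.single i 1) v := fun w u v ↦
    apply_eq_sum_single (f := fun u ↦ dualMetricDeriv θ y w u v)
      (fun a b ↦ by
        simp only [dualMetricDeriv, map_add, ← Finset.sum_add_distrib]
        exact Finset.sum_congr rfl fun _ _ ↦ by ring)
      (fun a b ↦ by
        simp only [dualMetricDeriv, map_smul, Finset.mul_sum, smul_eq_mul]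
        exact Finset.sum_congr rfl fun _ _ ↦ by ring) u
  have h3 : ∀ w u v, dualMetricDeriv θ y w u v
      = ∑ i, v i * dualMetricDeriv θ y w u (EuclideanSpace.single i 1) := fun w u v ↦
    apply_eq_sum_single (f := fun v ↦ dualMetricDeriv θ y w u v)
      (fun a b ↦ by
        simp only [dualMetricDeriv, map_add, ← Finset.sum_add_distrib]
        exact Finset.sum_congr rfl fun _ _ ↦ by ring)
      (fun a b ↦ by
        simp only [dualMetricDeriv, map_smul, Finset.mul_sum, smul_eq_mul]
        exact Finset.sum_congr rfl fun _ _ ↦ by ring) v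
  rw [h1]
  refine Finset.sum_congr rfl fun i _ ↦ ?_
  rw [h2, Finset.mul_sum]
  refine Finset.sum_congr rfl fun j _ ↦ ?_
  rw [h3, Finset.mul_sum, Finset.mul_sum]
  exact Finset.sum_congr rfl fun l _ ↦ by ring

variable {D : Set (EuclideanSpace ℝ (Fin m))}
  {X : Fin m → EuclideanSpace ℝ (Fin m) → EuclideanSpace ℝ (Fin m)}
  {θ : Fin m → EuclideanSpace ℝ (Fin m) → EuclideanSpace ℝ (Fin m) →L[ℝ] ℝ} {p : M}

/-- In the chart around `p`, the metric is `∑ θ_c ⊗ θ_c`. -/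
def IsDualMetric (D : Set (EuclideanSpace ℝ (Fin m)))
    (θ : Fin m → EuclideanSpace ℝ (Fin m) → EuclideanSpace ℝ (Fin m) →L[ℝ] ℝ) (p : M) : Prop :=
  ∀ z ∈ D, ∀ i j, metricMatrix p z i j =
    ∑ c, θ c z (EuclideanSpace.single i 1) * θ c z (EuclideanSpace.single j 1)

/-- If Θ is the matrix of the coframe, then g = ΘᵀΘ, and the matrix of the frame is Θ⁻¹. -/
theorem IsDualFrame.inv_metricMatrix (h : IsDualFrame D X θ) (hg : IsDualMetric D θ p)
    {y : EuclideanSpace ℝ (Fin m)} (hy : y ∈ D) :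
    (metricMatrix p y)⁻¹ = Matrix.of fun i j ↦ ∑ a, X a y i * X a y j := by
  refine Matrix.inv_eq_right_inv ?_
  ext i j
  have h1 : ∀ c a, ∑ l, θ c y (EuclideanSpace.single l 1) * X a y l = if c = a then 1 else 0 := by
    intro c a
    rw [← h.dual y hy c a]
    refine (Finset.sum_congr rfl fun l _ ↦ mul_comm _ _).trans ?_
    exact (apply_eq_sum_single (f := fun u ↦ θ c y u) (by simp) (by simp) (X a y)).symm
  have h2 := congrArg (fun u : EuclideanSpace ℝ (Fin m) ↦ u j)
    (h.sum_smul y hy (EuclideanSpace.single i 1))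
  simp only [WithLp.ofLp_sum, WithLp.ofLp_smul, Finset.sum_apply, Pi.smul_apply, smul_eq_mul]
    at h2
  rw [Matrix.mul_apply, Matrix.one_apply]
  have h3 : (EuclideanSpace.single i (1 : ℝ) : EuclideanSpace ℝ (Fin m)) j
      = if i = j then 1 else 0 := by
    simp [PiLp.single_apply, eq_comm]
  rw [← h3, ← h2]
  simp only [Matrix.of_apply, hg y hy]
  calc _ = ∑ l, ∑ c, ∑ a, θ c y (EuclideanSpace.single i 1) * X a y j *
        (θ c y (EuclideanSpace.single l 1) * X a y l) := by
        refine Finset.sum_congr rfl fun l _ ↦ ?_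
        rw [Finset.sum_mul]
        refine Finset.sum_congr rfl fun c _ ↦ ?_
        rw [Finset.mul_sum]
        exact Finset.sum_congr rfl fun a _ ↦ by ring
    _ = ∑ c, ∑ a, θ c y (EuclideanSpace.single i 1) * X a y j *
        ∑ l, (θ c y (EuclideanSpace.single l 1) * X a y l) := by
        rw [Finset.sum_comm]
        refine Finset.sum_congr rfl fun c _ ↦ ?_
        rw [Finset.sum_comm]
        exact Finset.sum_congr rfl fun a _ ↦ by rw [Finset.mul_sum]
    _ = _ := by simp [h1]

theorem IsDualFrame.partialDeriv_metricMatrix (h : IsDualFrame D X θ) (hg : IsDualMetric D θ p)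
    {y : EuclideanSpace ℝ (Fin m)} (hy : y ∈ D) (i j l : Fin m) :
    partialDeriv i (fun z ↦ metricMatrix p z j l) y =
      dualMetricDeriv θ y (EuclideanSpace.single i 1) (EuclideanSpace.single j 1)
        (EuclideanSpace.single l 1) := by
  have h1 : (fun z ↦ metricMatrix p z j l) =ᶠ[𝓝 y] fun z ↦
      ∑ c, θ c z (EuclideanSpace.single j 1) * θ c z (EuclideanSpace.single l 1) := by
    filter_upwards [h.isOpen.mem_nhds hy] with z hz using hg z hz j l
  have h2 : ∀ c (u : EuclideanSpace ℝ (Fin m)), HasFDerivAt (fun z ↦ θ c z u)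
      ((fderiv ℝ (θ c) y).flip u) y := fun c u ↦ by
    simpa using (h.differentiableAt_dual hy c).hasFDerivAt.clm_apply (hasFDerivAt_const u y)
  have h3 := (HasFDerivAt.fun_sum (u := Finset.univ) fun c _ ↦
    (h2 c (EuclideanSpace.single j 1)).mul (h2 c (EuclideanSpace.single l 1))).congr_of_eventuallyEq
    h1
  rw [partialDeriv, h3.fderiv, dualMetricDeriv]
  simp only [sum_apply, add_apply, smul_apply, smul_eq_mul, ContinuousLinearMap.flip_apply]
  exact Finset.sum_congr rfl fun c _ ↦ by ring

/-- Since g⁻¹ = ∑ X_a ⊗ X_a, applying θ_b to Γ(u, u) gives the lowered symbol in the direction X_b;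
on the diagonal its first two terms agree. -/
theorem IsDualFrame.dual_christoffelForm (h : IsDualFrame D X θ) (hg : IsDualMetric D θ p)
    {y : EuclideanSpace ℝ (Fin m)} (hy : y ∈ D) (b : Fin m) (u : EuclideanSpace ℝ (Fin m)) :
    θ b y (christoffelForm p y u u) =
      dualMetricDeriv θ y u u (X b y) - 1 / 2 * dualMetricDeriv θ y (X b y) u u := by
  set d : Fin m → Fin m → Fin m → ℝ := fun i j l ↦ dualMetricDeriv θ y (EuclideanSpace.single i 1)
    (EuclideanSpace.single j 1) (EuclideanSpace.single l 1) with hd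
  set S : Fin m → ℝ := fun a ↦ ∑ i, ∑ j, ∑ l,
    1 / 2 * (u i * u j * X a y l * (d i j l + d j i l - d l i j)) with hS
  have hΓ : christoffelForm p y u u = ∑ a, S a • X a y := by
    ext k
    simp only [christoffelForm, christoffel, h.partialDeriv_metricMatrix hg hy,
      h.inv_metricMatrix hg hy, Matrix.of_apply, WithLp.ofLp_sum, WithLp.ofLp_smul,
      Finset.sum_apply, Pi.smul_apply, smul_eq_mul, hS]
    simp only [Finset.sum_mul, Finset.mul_sum]
    rw [Finset.sum_comm (s := Finset.univ (α := Fin m)) (t := Finset.univ (α := Fin m))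
      (f := fun a i ↦ ∑ j, ∑ l, 1 / 2 * (u i * u j * X a y l * (d i j l + d j i l - d l i j)) *
        X a y k)]
    refine Finset.sum_congr rfl fun i _ ↦ ?_
    rw [Finset.sum_comm (f := fun a j ↦ ∑ l, 1 / 2 * (u i * u j * X a y l *
      (d i j l + d j i l - d l i j)) * X a y k)]
    refine Finset.sum_congr rfl fun j _ ↦ ?_
    rw [Finset.sum_comm (f := fun a l ↦ 1 / 2 * (u i * u j * X a y l *
      (d i j l + d j i l - d l i j)) * X a y k)]
    refine Finset.sum_congr rfl fun l _ ↦ Finset.sum_congr rfl fun a _ ↦ ?_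
    simp only [hd]
    ring
  have hb : θ b y (christoffelForm p y u u) = S b := by
    rw [hΓ]
    simp [h.dual y hy]
  have e1 : dualMetricDeriv θ y u u (X b y) = ∑ i, ∑ j, ∑ l, u i * u j * X b y l * d i j l :=
    dualMetricDeriv_eq_sum θ y u u (X b y)
  have e2 : dualMetricDeriv θ y u u (X b y) = ∑ i, ∑ j, ∑ l, u i * u j * X b y l * d j i l := by
    rw [e1, Finset.sum_comm]
    exact Finset.sum_congr rfl fun i _ ↦ Finset.sum_congr rfl fun j _ ↦
      Finset.sum_congr rfl fun l _ ↦ by ring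
  have e3 : dualMetricDeriv θ y (X b y) u u = ∑ i, ∑ j, ∑ l, u i * u j * X b y l * d l i j := by
    rw [dualMetricDeriv_eq_sum, Finset.sum_comm]
    refine Finset.sum_congr rfl fun i _ ↦ ?_
    rw [Finset.sum_comm]
    exact Finset.sum_congr rfl fun j _ ↦ Finset.sum_congr rfl fun l _ ↦ by ring
  have e4 : S b = 1 / 2 * (dualMetricDeriv θ y u u (X b y) + dualMetricDeriv θ y u u (X b y)
      - dualMetricDeriv θ y (X b y) u u) := by
    nth_rw 1 [e1]
    rw [e2, e3]
    simp only [hS, ← Finset.sum_add_distrib, ← Finset.sum_sub_distrib, Finset.mul_sum]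
    exact Finset.sum_congr rfl fun i _ ↦ Finset.sum_congr rfl fun j _ ↦
      Finset.sum_congr rfl fun l _ ↦ by ring
  rw [hb, e4]
  ring

/-- The Koszul formula `g(∇_{X_a} X_a, X_b) = g([X_b, X_a], X_a)` for an orthonormal frame. -/
theorem IsDualFrame.dual_covariantDeriv (h : IsDualFrame D X θ) (hg : IsDualMetric D θ p)
    {y : EuclideanSpace ℝ (Fin m)} (hy : y ∈ D) (a b : Fin m) :
    θ b y (fderiv ℝ (X a) y (X a y) + christoffelForm p y (X a y) (X a y)) =
      θ a y (lieBracket ℝ (X b) (X a) y) := by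
  rw [h.dual_lieBracket hy, map_add, h.dual_christoffelForm hg hy]
  have h1 := h.fderiv_dual_apply hy b a (X a y)
  have h2 : dualMetricDeriv θ y (X a y) (X a y) (X b y) =
      fderiv ℝ (θ b) y (X a y) (X a y) + fderiv ℝ (θ a) y (X a y) (X b y) := by
    simp [dualMetricDeriv, h.dual y hy, Finset.sum_add_distrib]
  have h3 : dualMetricDeriv θ y (X b y) (X a y) (X a y) = 2 * fderiv ℝ (θ a) y (X b y) (X a y) := by
    simp [dualMetricDeriv, h.dual y hy, Finset.sum_add_distrib]
    ring
  rw [h2, h3]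
  linarith

end FrameMetric

section CoordMap

variable {m n : ℕ}
  {M : Type*} [TopologicalSpace M] [ChartedSpace (EuclideanSpace ℝ (Fin m)) M]
  {N : Type*} [TopologicalSpace N] [ChartedSpace (EuclideanSpace ℝ (Fin n)) N]

theorem partialDeriv_coordMap {φ : M → N} {p : M} {z : EuclideanSpace ℝ (Fin m)}
    (hΦ : DifferentiableAt ℝ (writtenInExtChartAt (𝓡 m) (𝓡 n) p φ) z) (c : Fin n) (i : Fin m) :
    partialDeriv i (coordMap φ p c) z =
      (fderiv ℝ (writtenInExtChartAt (𝓡 m) (𝓡 n) p φ) z (EuclideanSpace.single i 1) :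
        EuclideanSpace ℝ (Fin n)) c := by
  have h := (EuclideanSpace.proj c : EuclideanSpace ℝ (Fin n) →L[ℝ] ℝ).hasFDerivAt.comp z
    hΦ.hasFDerivAt
  exact congrArg (fun T : EuclideanSpace ℝ (Fin m) →L[ℝ] ℝ ↦ T (EuclideanSpace.single i 1)) h.fderiv

end CoordMap

/-! ### The tension field as a sum over a frame -/

section Tension

open Filter Topology VectorField

variable {m n : ℕ}
  {M : Type*} [TopologicalSpace M] [ChartedSpace (EuclideanSpace ℝ (Fin m)) M]
  [RiemannianBundle (fun x : M ↦ TangentSpace (𝓡 m) x)]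
  {N : Type*} [TopologicalSpace N] [ChartedSpace (EuclideanSpace ℝ (Fin n)) N]
  [RiemannianBundle (fun x : N ↦ TangentSpace (𝓡 n) x)]

/-- Turns the components of ∇dφ into the quadratic form D²Φ(u, u) - DΦ(Γ(u, u)) + Γ(DΦ u, DΦ u),
which can be evaluated on frame vectors. -/
theorem sum_secondFundForm {φ : M → N} {p : M}
    (hΦ : ContDiffAt ℝ 2 (writtenInExtChartAt (𝓡 m) (𝓡 n) p φ) (extChartAt (𝓡 m) p p))
    (c : Fin n) (u : EuclideanSpace ℝ (Fin m)) :
    ∑ i, ∑ j, u i * u j * secondFundForm φ p c i j =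
      (fderiv ℝ (fderiv ℝ (writtenInExtChartAt (𝓡 m) (𝓡 n) p φ)) (extChartAt (𝓡 m) p p) u u
        - fderiv ℝ (writtenInExtChartAt (𝓡 m) (𝓡 n) p φ) (extChartAt (𝓡 m) p p)
            (christoffelForm p (extChartAt (𝓡 m) p p) u u)
        + christoffelForm (φ p) (extChartAt (𝓡 n) (φ p) (φ p))
            (fderiv ℝ (writtenInExtChartAt (𝓡 m) (𝓡 n) p φ) (extChartAt (𝓡 m) p p) u)
            (fderiv ℝ (writtenInExtChartAt (𝓡 m) (𝓡 n) p φ) (extChartAt (𝓡 m) p p) u) :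
        EuclideanSpace ℝ (Fin n)) c := by
  set Φ : EuclideanSpace ℝ (Fin m) → EuclideanSpace ℝ (Fin n) :=
    writtenInExtChartAt (𝓡 m) (𝓡 n) p φ with hΦdef
  set y : EuclideanSpace ℝ (Fin m) := extChartAt (𝓡 m) p p with hy
  have hd : DifferentiableAt ℝ Φ y := hΦ.differentiableAt (by simp)
  have hev : ∀ᶠ z in 𝓝 y, DifferentiableAt ℝ Φ z := by
    filter_upwards [hΦ.eventually (by simp)] with z hz using hz.differentiableAt (by simp)
  have hdd : DifferentiableAt ℝ (fderiv ℝ Φ) y :=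
    (hΦ.fderiv_right (m := 1) (by norm_num)).differentiableAt (by simp)
  have h2 : ∀ i j, partialDeriv i (partialDeriv j (coordMap φ p c)) y =
      fderiv ℝ (fderiv ℝ Φ) y (EuclideanSpace.single i 1) (EuclideanSpace.single j 1) c := by
    intro i j
    have e : partialDeriv j (coordMap φ p c) =ᶠ[𝓝 y]
        fun z ↦ (fderiv ℝ Φ z (EuclideanSpace.single j 1)) c := by
      filter_upwards [hev] with z hz using partialDeriv_coordMap hz c j
    have h := ((EuclideanSpace.proj c : EuclideanSpace ℝ (Fin n) →L[ℝ] ℝ).hasFDerivAt.comp y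
      (hdd.hasFDerivAt.clm_apply
        (hasFDerivAt_const (EuclideanSpace.single j 1) y))).congr_of_eventuallyEq e
    rw [partialDeriv, h.fderiv]
    simp
  have h1 : ∀ i (a : Fin n), partialDeriv i (coordMap φ p a) y =
      fderiv ℝ Φ y (EuclideanSpace.single i 1) a := fun i a ↦ partialDeriv_coordMap hd a i
  have t1 : fderiv ℝ (fderiv ℝ Φ) y u u c = ∑ i, ∑ j, u i * u j *
      fderiv ℝ (fderiv ℝ Φ) y (EuclideanSpace.single i 1) (EuclideanSpace.single j 1) c := by
    rw [apply_eq_sum_single (f := fun w ↦ fderiv ℝ (fderiv ℝ Φ) y w u c) (by simp) (by simp) u]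
    refine Finset.sum_congr rfl fun i _ ↦ ?_
    rw [clm_apply_eq_sum_single, Finset.mul_sum]
    exact Finset.sum_congr rfl fun j _ ↦ by ring
  have t2 : fderiv ℝ Φ y (christoffelForm p y u u) c = ∑ i, ∑ j, u i * u j *
      ∑ k, christoffel p k i j y * fderiv ℝ Φ y (EuclideanSpace.single k 1) c := by
    rw [clm_apply_eq_sum_single]
    simp only [christoffelForm, Finset.sum_mul, Finset.mul_sum]
    rw [Finset.sum_comm]
    refine Finset.sum_congr rfl fun i _ ↦ ?_
    rw [Finset.sum_comm]
    exact Finset.sum_congr rfl fun j _ ↦ Finset.sum_congr rfl fun k _ ↦ by ring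
  have t3 : christoffelForm (φ p) (extChartAt (𝓡 n) (φ p) (φ p)) (fderiv ℝ Φ y u)
      (fderiv ℝ Φ y u) c = ∑ i, ∑ j, u i * u j * ∑ a, ∑ b,
      christoffel (φ p) c a b (extChartAt (𝓡 n) (φ p) (φ p)) *
        fderiv ℝ Φ y (EuclideanSpace.single i 1) a * fderiv ℝ Φ y (EuclideanSpace.single j 1) b := by
    simp only [christoffelForm, Finset.mul_sum]
    have e : ∀ a b, christoffel (φ p) c a b (extChartAt (𝓡 n) (φ p) (φ p)) * fderiv ℝ Φ y u a *
        fderiv ℝ Φ y u b = ∑ i, ∑ j, u i * u j *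
          (christoffel (φ p) c a b (extChartAt (𝓡 n) (φ p) (φ p)) *
          fderiv ℝ Φ y (EuclideanSpace.single i 1) a *
          fderiv ℝ Φ y (EuclideanSpace.single j 1) b) := by
      intro a b
      rw [clm_apply_eq_sum_single (fderiv ℝ Φ y) u a, clm_apply_eq_sum_single (fderiv ℝ Φ y) u b]
      simp only [Finset.mul_sum, Finset.sum_mul]
      rw [Finset.sum_comm]
      exact Finset.sum_congr rfl fun i _ ↦ Finset.sum_congr rfl fun j _ ↦ by ring
    simp only [e]
    calc _ = ∑ a, ∑ i, ∑ j, ∑ b, u i * u j *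
          (christoffel (φ p) c a b (extChartAt (𝓡 n) (φ p) (φ p)) *
          fderiv ℝ Φ y (EuclideanSpace.single i 1) a *
          fderiv ℝ Φ y (EuclideanSpace.single j 1) b) := by
          refine Finset.sum_congr rfl fun a _ ↦ ?_
          rw [Finset.sum_comm]
          exact Finset.sum_congr rfl fun i _ ↦ Finset.sum_comm
      _ = _ := by
          rw [Finset.sum_comm]
          exact Finset.sum_congr rfl fun i _ ↦ Finset.sum_comm
  have : ∀ v w x : EuclideanSpace ℝ (Fin n), (v - w + x) c = v c - w c + x c := fun _ _ _ ↦ rfl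
  rw [this, t1, t2, t3]
  simp only [← Finset.sum_sub_distrib, ← Finset.sum_add_distrib]
  refine Finset.sum_congr rfl fun i _ ↦ Finset.sum_congr rfl fun j _ ↦ ?_
  simp only [secondFundForm, ← hy, h1, h2]
  ring

/-- Substituting g^{ij} = ∑_a X_a^i X_a^j turns the metric trace into the sum of ∇dφ(X_a, X_a). -/
theorem tensionField_eq_sum {φ : M → N} {p : M}
    (hΦ : ContDiffAt ℝ 2 (writtenInExtChartAt (𝓡 m) (𝓡 n) p φ) (extChartAt (𝓡 m) p p))
    {D : Set (EuclideanSpace ℝ (Fin m))}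
    {X : Fin m → EuclideanSpace ℝ (Fin m) → EuclideanSpace ℝ (Fin m)}
    {θ : Fin m → EuclideanSpace ℝ (Fin m) → EuclideanSpace ℝ (Fin m) →L[ℝ] ℝ}
    (h : IsDualFrame D X θ) (hg : IsDualMetric D θ p) (hy : extChartAt (𝓡 m) p p ∈ D) :
    (tensionField m n φ p : EuclideanSpace ℝ (Fin n)) = ∑ a,
      (fderiv ℝ (fderiv ℝ (writtenInExtChartAt (𝓡 m) (𝓡 n) p φ)) (extChartAt (𝓡 m) p p)
          (X a (extChartAt (𝓡 m) p p)) (X a (extChartAt (𝓡 m) p p))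
        - fderiv ℝ (writtenInExtChartAt (𝓡 m) (𝓡 n) p φ) (extChartAt (𝓡 m) p p)
            (christoffelForm p (extChartAt (𝓡 m) p p)
              (X a (extChartAt (𝓡 m) p p)) (X a (extChartAt (𝓡 m) p p)))
        + christoffelForm (φ p) (extChartAt (𝓡 n) (φ p) (φ p))
            (fderiv ℝ (writtenInExtChartAt (𝓡 m) (𝓡 n) p φ) (extChartAt (𝓡 m) p p)
              (X a (extChartAt (𝓡 m) p p)))
            (fderiv ℝ (writtenInExtChartAt (𝓡 m) (𝓡 n) p φ) (extChartAt (𝓡 m) p p)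
              (X a (extChartAt (𝓡 m) p p))) : EuclideanSpace ℝ (Fin n)) := by
  refine PiLp.ext (p := 2) (α := fun _ : Fin n ↦ ℝ) fun c ↦ ?_
  rw [WithLp.ofLp_sum, Finset.sum_apply]
  simp only [← sum_secondFundForm hΦ c]
  change ∑ i, ∑ j, (metricMatrix p (extChartAt (𝓡 m) p p))⁻¹ i j * secondFundForm φ p c i j = _
  rw [h.inv_metricMatrix hg hy]
  simp only [Matrix.of_apply, Finset.sum_mul]
  symm
  rw [Finset.sum_comm]
  refine Finset.sum_congr rfl fun i _ ↦ ?_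
  rw [Finset.sum_comm]

end Tension

/-! ### Related vector fields in vector spaces -/

section RelatedFields

open Filter Topology VectorField

variable {E E' : Type*} [NormedAddCommGroup E] [NormedSpace ℝ E] [NormedAddCommGroup E']
  [NormedSpace ℝ E']

/-- Differentiate DΦ(X) = Y ∘ Φ in the direction u. -/
theorem fderiv_fderiv_apply_of_related {Φ : E → E'} {y : E} (hΦ : ContDiffAt ℝ 2 Φ y)
    {X : E → E} {Y : E' → E'} (hX : DifferentiableAt ℝ X y) (hY : DifferentiableAt ℝ Y (Φ y))
    (h : ∀ᶠ z in 𝓝 y, fderiv ℝ Φ z (X z) = Y (Φ z)) (u : E) :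
    fderiv ℝ (fderiv ℝ Φ) y u (X y) + fderiv ℝ Φ y (fderiv ℝ X y u) =
      fderiv ℝ Y (Φ y) (fderiv ℝ Φ y u) := by
  have hdd : DifferentiableAt ℝ (fderiv ℝ Φ) y :=
    (hΦ.fderiv_right (m := 1) (by norm_num)).differentiableAt (by simp)
  have h1 := hdd.hasFDerivAt.clm_apply hX.hasFDerivAt
  have h2 := (hY.hasFDerivAt.comp y (hΦ.differentiableAt (by simp)).hasFDerivAt)
  have h3 := congrArg (fun T : E →L[ℝ] E' ↦ T u)
    (h1.unique (h2.congr_of_eventuallyEq h))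
  simp at h3
  rw [← h3]
  abel

/-- The bracket of related fields is related. -/
theorem fderiv_lieBracket_of_related {Φ : E → E'} {y : E} (hΦ : ContDiffAt ℝ 2 Φ y)
    {X₁ X₂ : E → E} {Y₁ Y₂ : E' → E'} (hX₁ : DifferentiableAt ℝ X₁ y)
    (hX₂ : DifferentiableAt ℝ X₂ y) (hY₁ : DifferentiableAt ℝ Y₁ (Φ y))
    (hY₂ : DifferentiableAt ℝ Y₂ (Φ y)) (h₁ : ∀ᶠ z in 𝓝 y, fderiv ℝ Φ z (X₁ z) = Y₁ (Φ z))
    (h₂ : ∀ᶠ z in 𝓝 y, fderiv ℝ Φ z (X₂ z) = Y₂ (Φ z)) :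
    fderiv ℝ Φ y (lieBracket ℝ X₁ X₂ y) = lieBracket ℝ Y₁ Y₂ (Φ y) := by
  have e₁ := fderiv_fderiv_apply_of_related hΦ hX₁ hY₁ h₁ (X₂ y)
  have e₂ := fderiv_fderiv_apply_of_related hΦ hX₂ hY₂ h₂ (X₁ y)
  -- Symmetry of D²Φ makes the second-order terms cancel in the bracket.
  rw [(hΦ.isSymmSndFDerivAt (by simp)) (X₁ y) (X₂ y), h₁.self_of_nhds] at e₂
  rw [h₂.self_of_nhds] at e₁
  rw [lieBracket, lieBracket, map_sub, ← e₁, ← e₂]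
  abel

end RelatedFields

/-! ### Tension field of a map with an adapted frame -/

section AdaptedTension

open Filter Topology VectorField

variable {n : ℕ}
  {M : Type*} [TopologicalSpace M] [ChartedSpace (EuclideanSpace ℝ (Fin (n + 1))) M]
  [RiemannianBundle (fun x : M ↦ TangentSpace (𝓡 (n + 1)) x)]
  {N : Type*} [TopologicalSpace N] [ChartedSpace (EuclideanSpace ℝ (Fin n)) N]
  [RiemannianBundle (fun x : N ↦ TangentSpace (𝓡 n) x)]

/-- The components of the tension field in an adapted frame are `-g([e_k, e_{n+1}], e_{n+1})`. -/
theorem dual_tensionField {φ : M → N} {p : M}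
    (hΦ : ContDiffAt ℝ 2 (writtenInExtChartAt (𝓡 (n + 1)) (𝓡 n) p φ)
      (extChartAt (𝓡 (n + 1)) p p))
    {D : Set (EuclideanSpace ℝ (Fin (n + 1)))}
    {X : Fin (n + 1) → EuclideanSpace ℝ (Fin (n + 1)) → EuclideanSpace ℝ (Fin (n + 1))}
    {θ : Fin (n + 1) → EuclideanSpace ℝ (Fin (n + 1)) → EuclideanSpace ℝ (Fin (n + 1)) →L[ℝ] ℝ}
    (h : IsDualFrame D X θ) (hg : IsDualMetric D θ p) (hy : extChartAt (𝓡 (n + 1)) p p ∈ D)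
    {D' : Set (EuclideanSpace ℝ (Fin n))}
    {Y : Fin n → EuclideanSpace ℝ (Fin n) → EuclideanSpace ℝ (Fin n)}
    {η : Fin n → EuclideanSpace ℝ (Fin n) → EuclideanSpace ℝ (Fin n) →L[ℝ] ℝ}
    (h' : IsDualFrame D' Y η) (hg' : IsDualMetric D' η (φ p))
    (hy' : extChartAt (𝓡 n) (φ p) (φ p) ∈ D')
    (hrel : ∀ i : Fin n, ∀ᶠ z in 𝓝 (extChartAt (𝓡 (n + 1)) p p),
      fderiv ℝ (writtenInExtChartAt (𝓡 (n + 1)) (𝓡 n) p φ) z (X i.castSucc z) =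
        Y i (writtenInExtChartAt (𝓡 (n + 1)) (𝓡 n) p φ z))
    (hver : ∀ᶠ z in 𝓝 (extChartAt (𝓡 (n + 1)) p p),
      fderiv ℝ (writtenInExtChartAt (𝓡 (n + 1)) (𝓡 n) p φ) z (X (Fin.last n) z) = 0)
    (k : Fin n) :
    η k (extChartAt (𝓡 n) (φ p) (φ p)) (tensionField (n + 1) n φ p : EuclideanSpace ℝ (Fin n)) =
      -θ (Fin.last n) (extChartAt (𝓡 (n + 1)) p p)
        (lieBracket ℝ (X k.castSucc) (X (Fin.last n)) (extChartAt (𝓡 (n + 1)) p p)) := by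
  rw [tensionField_eq_sum hΦ h hg hy]
  have hΦy : writtenInExtChartAt (𝓡 (n + 1)) (𝓡 n) p φ (extChartAt (𝓡 (n + 1)) p p) =
      extChartAt (𝓡 n) (φ p) (φ p) := by simp [writtenInExtChartAt]
  set Φ : EuclideanSpace ℝ (Fin (n + 1)) → EuclideanSpace ℝ (Fin n) :=
    writtenInExtChartAt (𝓡 (n + 1)) (𝓡 n) p φ with hΦdef
  set y : EuclideanSpace ℝ (Fin (n + 1)) := extChartAt (𝓡 (n + 1)) p p with hydef
  set y' : EuclideanSpace ℝ (Fin n) := extChartAt (𝓡 n) (φ p) (φ p) with hydef'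
  -- The base coframe pulls back to the horizontal part of the coframe upstairs.
  have hcomp : ∀ k : Fin n, (η k y').comp (fderiv ℝ Φ y) = θ k.castSucc y := by
    intro k
    refine h.clm_ext hy fun a ↦ ?_
    rw [ContinuousLinearMap.comp_apply, h.dual y hy]
    refine Fin.lastCases ?_ (fun i ↦ ?_) a
    · rw [hver.self_of_nhds, map_zero, if_neg (Fin.castSucc_lt_last k).ne]
    · rw [(hrel i).self_of_nhds, hΦy, h'.dual y' hy']
      simp
  have hcomp' : ∀ k u, η k y' (fderiv ℝ Φ y u) = θ k.castSucc y u := fun k u ↦ by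
    rw [← hcomp]; rfl
  rw [Fin.sum_univ_castSucc, map_add, map_sum]
  -- X_{n+1} is related to the zero field, so the vertical term of the trace reduces to
  -- -DΦ(∇_{X_{n+1}} X_{n+1}).
  have hvert : fderiv ℝ (fderiv ℝ Φ) y (X (Fin.last n) y) (X (Fin.last n) y) =
      -fderiv ℝ Φ y (fderiv ℝ (X (Fin.last n)) y (X (Fin.last n) y)) := by
    have := fderiv_fderiv_apply_of_related (Y := fun _ ↦ 0) hΦ (h.differentiableAt hy (Fin.last n))
      (differentiableAt_const 0) hver (X (Fin.last n) y)
    rw [fderiv_const_apply, zero_apply] at this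
    exact eq_neg_of_add_eq_zero_left this
  -- The term is ∇_{Y_i} Y_i - DΦ(∇_{X_i} X_i). By the Koszul formula both parts have k-th component
  -- η_i([Y_k, Y_i]), as brackets of related fields are related.
  have hhor : ∀ i : Fin n, η k y' (fderiv ℝ (fderiv ℝ Φ) y (X i.castSucc y) (X i.castSucc y)
        - fderiv ℝ Φ y (christoffelForm p y (X i.castSucc y) (X i.castSucc y))
        + christoffelForm (φ p) y' (fderiv ℝ Φ y (X i.castSucc y))
            (fderiv ℝ Φ y (X i.castSucc y))) = 0 := by
    intro i
    have hYi : DifferentiableAt ℝ (Y i) (Φ y) := by rw [hΦy]; exact h'.differentiableAt hy' i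
    have hYk : DifferentiableAt ℝ (Y k) (Φ y) := by rw [hΦy]; exact h'.differentiableAt hy' k
    have e1 := fderiv_fderiv_apply_of_related hΦ (h.differentiableAt hy i.castSucc) hYi (hrel i)
      (X i.castSucc y)
    have e2 := h.dual_covariantDeriv hg hy i.castSucc k.castSucc
    have e3 := h'.dual_covariantDeriv hg' hy' i k
    have e4 := fderiv_lieBracket_of_related hΦ (h.differentiableAt hy k.castSucc)
      (h.differentiableAt hy i.castSucc) hYk hYi (hrel k) (hrel i)
    rw [(hrel i).self_of_nhds, hΦy] at e1 ⊢
    rw [← hcomp', ← hcomp', e4, hΦy, ← e3, map_add, map_add, map_add, ← e1, map_add] at e2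
    rw [map_add, map_sub]
    linarith
  rw [Finset.sum_eq_zero fun i _ ↦ hhor i, zero_add, hvert, hver.self_of_nhds]
  have hz : christoffelForm (φ p) y' 0 0 = 0 := by
    ext c
    simp [christoffelForm]
  have e := h.dual_covariantDeriv hg hy (Fin.last n) k.castSucc
  rw [map_add] at e
  rw [hz, add_zero, map_sub, map_neg, hcomp', hcomp', ← e]
  ring

end AdaptedTension

/-! ### Vector fields in coordinates -/

theorem mlieBracket_eq_lieBracket {E : Type*} [NormedAddCommGroup E] [NormedSpace ℝ E]
    (V W : (x : E) → TangentSpace 𝓘(ℝ, E) x) :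
    VectorField.mlieBracket 𝓘(ℝ, E) V W = VectorField.lieBracket ℝ V W := by
  rw [← VectorField.mlieBracketWithin_univ, VectorField.mlieBracketWithin_eq_lieBracketWithin]
  exact VectorField.lieBracketWithin_univ

section CoordField

open Set Filter Topology VectorField

variable {m : ℕ} {M : Type*} [TopologicalSpace M] [ChartedSpace (EuclideanSpace ℝ (Fin m)) M]

/-- The coordinate expression, in the chart around `p`, of a vector field. -/
def coordField (p : M) (V : (x : M) → TangentSpace (𝓡 m) x) (y : EuclideanSpace ℝ (Fin m)) :
    EuclideanSpace ℝ (Fin m) :=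
  mpullback 𝓘(ℝ, EuclideanSpace ℝ (Fin m)) (𝓡 m) (extChartAt (𝓡 m) p).symm V y

/-- The part of the chart around `p` that lies over `U`. -/
def coordDomain (p : M) (U : Set M) : Set (EuclideanSpace ℝ (Fin m)) :=
  (extChartAt (𝓡 m) p).target ∩ (extChartAt (𝓡 m) p).symm ⁻¹' U

theorem isOpen_coordDomain (p : M) {U : Set M} (hU : IsOpen U) :
    IsOpen (coordDomain (m := m) p U) :=
  (continuousOn_extChartAt_symm (I := 𝓡 m) p).isOpen_inter_preimage
    (isOpen_extChartAt_target p) hU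

theorem mem_coordDomain {p : M} {U : Set M} (hp : p ∈ U) :
    extChartAt (𝓡 m) p p ∈ coordDomain (m := m) p U :=
  ⟨mem_extChartAt_target p, by simpa using hp⟩

theorem mem_coordDomain_preimage_source {n : ℕ} {N : Type*} [TopologicalSpace N]
    [ChartedSpace (EuclideanSpace ℝ (Fin n)) N] (φ : M → N) (p : M) :
    extChartAt (𝓡 m) p p ∈ coordDomain (m := m) p (φ ⁻¹' (extChartAt (𝓡 n) (φ p)).source) :=
  mem_coordDomain (mem_extChartAt_source (I := 𝓡 n) (φ p))

variable [IsManifold (𝓡 m) ∞ M]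

theorem isManifold_minSmoothness_two : IsManifold (𝓡 m) (minSmoothness ℝ 2) M := by
  rw [minSmoothness_of_isRCLikeNormedField]
  exact IsManifold.of_le (n := ∞) (WithTop.coe_le_coe.2 le_top)

theorem contMDiffAt_extChartAt_symm {p : M} {y : EuclideanSpace ℝ (Fin m)}
    (hy : y ∈ (extChartAt (𝓡 m) p).target) :
    ContMDiffAt 𝓘(ℝ, EuclideanSpace ℝ (Fin m)) (𝓡 m) ∞ (extChartAt (𝓡 m) p).symm y :=
  (contMDiffOn_extChartAt_symm p).contMDiffAt ((isOpen_extChartAt_target p).mem_nhds hy)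

/-- The differential of the inverse of the chart around `p`. -/
def coordDeriv (p : M) (y : EuclideanSpace ℝ (Fin m)) :
    EuclideanSpace ℝ (Fin m) →L[ℝ] TangentSpace (𝓡 m) ((extChartAt (𝓡 m) p).symm y) :=
  mfderiv (𝓡 m) (𝓡 m) (extChartAt (𝓡 m) p).symm y

theorem isInvertible_coordDeriv {p : M} {y : EuclideanSpace ℝ (Fin m)}
    (hy : y ∈ (extChartAt (𝓡 m) p).target) : (coordDeriv p y).IsInvertible := by
  have : IsManifold (𝓡 m) 1 M := IsManifold.of_le (n := ∞) (by simp)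
  have h := isInvertible_mfderivWithin_extChartAt_symm (I := 𝓡 m) hy
  rwa [ModelWithCorners.range_eq_univ, mfderivWithin_univ] at h

theorem coordDeriv_coordField {p : M} {y : EuclideanSpace ℝ (Fin m)}
    (hy : y ∈ (extChartAt (𝓡 m) p).target) (V : (x : M) → TangentSpace (𝓡 m) x) :
    coordDeriv p y (coordField p V y) = V ((extChartAt (𝓡 m) p).symm y) :=
  (isInvertible_coordDeriv hy).self_apply_inverse _

theorem coordField_eq_of_coordDeriv {p : M} {y u : EuclideanSpace ℝ (Fin m)}
    (hy : y ∈ (extChartAt (𝓡 m) p).target) {V : (x : M) → TangentSpace (𝓡 m) x}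
    (h : coordDeriv p y u = V ((extChartAt (𝓡 m) p).symm y)) : coordField p V y = u :=
  (isInvertible_coordDeriv hy).injective ((coordDeriv_coordField hy V).trans h.symm)

theorem contDiffOn_coordField (p : M) {U : Set M} (hU : IsOpen U)
    {V : (x : M) → TangentSpace (𝓡 m) x}
    (hV : ContMDiffOn (𝓡 m) (𝓡 m).tangent ∞ (fun x ↦ (⟨x, V x⟩ : TangentBundle (𝓡 m) M)) U) :
    ContDiffOn ℝ ∞ (coordField p V) (coordDomain p U) := by
  intro y hy
  have h := ContMDiffAt.mpullback_vectorField_preimage (m := ∞) (n := ∞)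
    (I := 𝓘(ℝ, EuclideanSpace ℝ (Fin m))) (f := (extChartAt (𝓡 m) p).symm) (V := V)
    (hV.contMDiffAt (hU.mem_nhds hy.2)) (contMDiffAt_extChartAt_symm hy.1)
    (isInvertible_coordDeriv hy.1) (by simp)
  exact (contMDiffAt_vectorSpace_iff_contDiffAt.1 h).contDiffWithinAt

theorem coordField_mlieBracket {p : M} {U : Set M} (hU : IsOpen U)
    {V W : (x : M) → TangentSpace (𝓡 m) x}
    (hV : ContMDiffOn (𝓡 m) (𝓡 m).tangent ∞ (fun x ↦ (⟨x, V x⟩ : TangentBundle (𝓡 m) M)) U)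
    (hW : ContMDiffOn (𝓡 m) (𝓡 m).tangent ∞ (fun x ↦ (⟨x, W x⟩ : TangentBundle (𝓡 m) M)) U)
    {y : EuclideanSpace ℝ (Fin m)} (hy : y ∈ coordDomain p U) :
    coordField p (mlieBracket (𝓡 m) V W) y =
      lieBracket ℝ (coordField p V) (coordField p W) y := by
  have := isManifold_minSmoothness_two (m := m) (M := M)
  have h := mpullback_mlieBracket (n := ∞) (I := 𝓘(ℝ, EuclideanSpace ℝ (Fin m)))
    (f := (extChartAt (𝓡 m) p).symm)
    ((hV.contMDiffAt (hU.mem_nhds hy.2)).mdifferentiableAt (by simp))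
    ((hW.contMDiffAt (hU.mem_nhds hy.2)).mdifferentiableAt (by simp))
    (contMDiffAt_extChartAt_symm hy.1)
    (by rw [minSmoothness_of_isRCLikeNormedField]; exact WithTop.coe_le_coe.2 le_top)
  exact h.trans (congrFun (mlieBracket_eq_lieBracket _ _) y)

theorem linearIndependent_coordField {p : M} {y : EuclideanSpace ℝ (Fin m)}
    (hy : y ∈ (extChartAt (𝓡 m) p).target) {ι : Type*}
    {V : ι → (x : M) → TangentSpace (𝓡 m) x}
    (h : LinearIndependent ℝ fun i ↦ V i ((extChartAt (𝓡 m) p).symm y)) :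
    LinearIndependent ℝ fun i ↦ coordField p (V i) y := by
  refine LinearIndependent.of_comp (coordDeriv p y).toLinearMap ?_
  convert h using 2 with i
  exact coordDeriv_coordField hy (V i)

theorem exists_isDualFrame_coordField (p : M) {U : Set M} (hU : IsOpen U)
    {V : Fin m → (x : M) → TangentSpace (𝓡 m) x}
    (hV : ∀ a, ContMDiffOn (𝓡 m) (𝓡 m).tangent ∞
      (fun x ↦ (⟨x, V a x⟩ : TangentBundle (𝓡 m) M)) U)
    (hli : ∀ x ∈ U, LinearIndependent ℝ fun a ↦ V a x) :
    ∃ θ, IsDualFrame (coordDomain p U) (fun a ↦ coordField p (V a)) θ :=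
  exists_isDualFrame (by simp) (isOpen_coordDomain p hU) (fun a ↦ contDiffOn_coordField p hU (hV a))
    fun y hy ↦ linearIndependent_coordField hy.1 (hli _ hy.2)

/-- Expand the coordinate fields in the frame; orthonormality leaves only the diagonal products of
coefficients. -/
theorem isDualMetric_of_orthonormal [RiemannianBundle (fun x : M ↦ TangentSpace (𝓡 m) x)]
    {p : M} {U : Set M} {V : Fin m → (x : M) → TangentSpace (𝓡 m) x}
    (hV : ∀ x ∈ U, Orthonormal ℝ fun a ↦ V a x)
    {θ : Fin m → EuclideanSpace ℝ (Fin m) → EuclideanSpace ℝ (Fin m) →L[ℝ] ℝ}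
    (h : IsDualFrame (coordDomain p U) (fun a ↦ coordField p (V a)) θ) :
    IsDualMetric (coordDomain p U) θ p := by
  intro y hy i j
  have h1 : ∀ i, coordVec p i y =
      ∑ c, θ c y (EuclideanSpace.single i 1) • V c ((extChartAt (𝓡 m) p).symm y) := by
    intro i
    change coordDeriv p y (EuclideanSpace.single i 1) = _
    nth_rw 1 [← h.sum_smul y hy (EuclideanSpace.single i 1)]
    rw [map_sum]
    refine Finset.sum_congr rfl fun c _ ↦ ?_
    rw [← coordDeriv_coordField hy.1 (V c), map_smul]
  rw [metricMatrix, Matrix.of_apply, h1, h1]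
  have h3 := (hV _ hy.2).inner_sum (fun c ↦ θ c y (EuclideanSpace.single i 1))
    (fun c ↦ θ c y (EuclideanSpace.single j 1)) Finset.univ
  simpa using h3

variable {n : ℕ} {N : Type*} [TopologicalSpace N] [ChartedSpace (EuclideanSpace ℝ (Fin n)) N]
  [IsManifold (𝓡 n) ∞ N]

/-- The chain rule in a chart around a fixed p. The base points of the two sides agree only
propositionally, so the vectors are compared in the common model space. -/
theorem mfderiv_eq_coordDeriv_fderiv {p : N} {Ψ : EuclideanSpace ℝ (Fin m) → EuclideanSpace ℝ (Fin n)}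
    {G : EuclideanSpace ℝ (Fin m) → N} {y : EuclideanSpace ℝ (Fin m)}
    (hd : DifferentiableAt ℝ Ψ y) (hy : Ψ y ∈ (extChartAt (𝓡 n) p).target)
    (hev : (extChartAt (𝓡 n) p).symm ∘ Ψ =ᶠ[𝓝 y] G) (u : EuclideanSpace ℝ (Fin m)) :
    (mfderiv (𝓡 m) (𝓡 n) G y u : EuclideanSpace ℝ (Fin n)) =
      coordDeriv p (Ψ y) (fderiv ℝ Ψ y u) := by
  have h1 : (mfderiv (𝓡 m) (𝓡 n) ((extChartAt (𝓡 n) p).symm ∘ Ψ) y u : EuclideanSpace ℝ (Fin n)) =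
      coordDeriv p (Ψ y) (fderiv ℝ Ψ y u) := by
    rw [mfderiv_comp y ((contMDiffAt_extChartAt_symm hy).mdifferentiableAt (by simp))
      hd.mdifferentiableAt, mfderiv_eq_fderiv]
    rfl
  rw [← h1, hev.mfderiv_eq (I := 𝓡 m) (I' := 𝓡 n)]
  rfl

variable {φ : M → N} {p : M} {y : EuclideanSpace ℝ (Fin m)}

theorem contDiffAt_writtenInExtChartAt (hφ : ContMDiff (𝓡 m) (𝓡 n) ∞ φ)
    (hy : y ∈ coordDomain p (φ ⁻¹' (extChartAt (𝓡 n) (φ p)).source)) :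
    ContDiffAt ℝ ∞ (writtenInExtChartAt (𝓡 m) (𝓡 n) p φ) y := by
  rw [← contMDiffAt_iff_contDiffAt]
  exact (contMDiffAt_extChartAt' (by simpa using hy.2)).comp y
    ((hφ _).comp y (contMDiffAt_extChartAt_symm hy.1))

theorem coordDeriv_fderiv_writtenInExtChartAt (hφ : ContMDiff (𝓡 m) (𝓡 n) ∞ φ)
    (hy : y ∈ coordDomain p (φ ⁻¹' (extChartAt (𝓡 n) (φ p)).source))
    (u : EuclideanSpace ℝ (Fin m)) :
    (mfderiv (𝓡 m) (𝓡 n) φ ((extChartAt (𝓡 m) p).symm y) (coordDeriv p y u) :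
      EuclideanSpace ℝ (Fin n)) =
      coordDeriv (φ p) (writtenInExtChartAt (𝓡 m) (𝓡 n) p φ y)
        (fderiv ℝ (writtenInExtChartAt (𝓡 m) (𝓡 n) p φ) y u) := by
  have hopen : IsOpen (coordDomain (m := m) p (φ ⁻¹' (extChartAt (𝓡 n) (φ p)).source)) :=
    isOpen_coordDomain p ((isOpen_extChartAt_source _).preimage hφ.continuous)
  have hev : (extChartAt (𝓡 n) (φ p)).symm ∘ writtenInExtChartAt (𝓡 m) (𝓡 n) p φ =ᶠ[𝓝 y]
      φ ∘ (extChartAt (𝓡 m) p).symm := by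
    filter_upwards [hopen.mem_nhds hy] with z hz
    exact (extChartAt (𝓡 n) (φ p)).left_inv hz.2
  rw [← mfderiv_eq_coordDeriv_fderiv
    ((contDiffAt_writtenInExtChartAt hφ hy).differentiableAt (by simp))
    ((extChartAt (𝓡 n) (φ p)).map_source hy.2) hev, mfderiv_comp y
    ((hφ _).mdifferentiableAt (by simp))
    ((contMDiffAt_extChartAt_symm hy.1).mdifferentiableAt (by simp))]
  rfl

/-- A map of manifolds relates two vector fields if and only if its coordinate expression relates
their coordinate expressions. -/
theorem fderiv_coordField_iff (hφ : ContMDiff (𝓡 m) (𝓡 n) ∞ φ)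
    (hy : y ∈ coordDomain p (φ ⁻¹' (extChartAt (𝓡 n) (φ p)).source))
    {V : (x : M) → TangentSpace (𝓡 m) x} {W : (x : N) → TangentSpace (𝓡 n) x} :
    fderiv ℝ (writtenInExtChartAt (𝓡 m) (𝓡 n) p φ) y (coordField p V y) =
      coordField (φ p) W (writtenInExtChartAt (𝓡 m) (𝓡 n) p φ y) ↔
    mfderiv (𝓡 m) (𝓡 n) φ ((extChartAt (𝓡 m) p).symm y) (V ((extChartAt (𝓡 m) p).symm y)) =
      W (φ ((extChartAt (𝓡 m) p).symm y)) := by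
  have hΦy : writtenInExtChartAt (𝓡 m) (𝓡 n) p φ y ∈ (extChartAt (𝓡 n) (φ p)).target :=
    (extChartAt (𝓡 n) (φ p)).map_source hy.2
  have h1 := coordDeriv_fderiv_writtenInExtChartAt hφ hy (coordField p V y)
  rw [coordDeriv_coordField hy.1] at h1
  have h2 : (coordDeriv (φ p) (writtenInExtChartAt (𝓡 m) (𝓡 n) p φ y)
      (coordField (φ p) W (writtenInExtChartAt (𝓡 m) (𝓡 n) p φ y)) : EuclideanSpace ℝ (Fin n)) =
      W (φ ((extChartAt (𝓡 m) p).symm y)) := by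
    rw [coordDeriv_coordField hΦy]
    exact congrArg (fun x ↦ (W x : EuclideanSpace ℝ (Fin n)))
      ((extChartAt (𝓡 n) (φ p)).left_inv hy.2)
  rw [← (isInvertible_coordDeriv hΦy).injective.eq_iff]
  exact ⟨fun h ↦ h1.trans (h.trans h2), fun h ↦ h1.symm.trans (h.trans h2.symm)⟩

end CoordField

/-! ### Orthonormal frames -/

section Orthonormal

variable {F : Type*} [NormedAddCommGroup F] [InnerProductSpace ℝ F] [FiniteDimensional ℝ F]
  {ι : Type*} [Fintype ι]

theorem sum_inner_smul_of_orthonormal {v : ι → F} (hv : Orthonormal ℝ v)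
    (hcard : Fintype.card ι = Module.finrank ℝ F) (x : F) : ∑ i, inner ℝ (v i) x • v i = x := by
  have hspan : ⊤ ≤ Submodule.span ℝ (Set.range v) :=
    (hv.linearIndependent.span_eq_top_of_card_eq_finrank' hcard).ge
  simpa using (OrthonormalBasis.mk hv hspan).sum_repr' x

theorem inner_map_map_of_orthonormal {F' : Type*} [NormedAddCommGroup F'] [InnerProductSpace ℝ F']
    {v : ι → F} (hv : Orthonormal ℝ v) (hcard : Fintype.card ι = Module.finrank ℝ F)
    {T : F →ₗ[ℝ] F'} (hT : Orthonormal ℝ fun i ↦ T (v i)) (x y : F) :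
    inner ℝ (T x) (T y) = inner ℝ x y := by
  rw [← sum_inner_smul_of_orthonormal hv hcard x, ← sum_inner_smul_of_orthonormal hv hcard y]
  simp only [map_sum, map_smul]
  rw [hT.inner_sum, hv.inner_sum]

end Orthonormal

section TangentFrame

variable {m : ℕ} {M : Type*} [TopologicalSpace M] [ChartedSpace (EuclideanSpace ℝ (Fin m)) M]

theorem finiteDimensional_tangentSpace (x : M) : FiniteDimensional ℝ (TangentSpace (𝓡 m) x) :=
  inferInstanceAs (FiniteDimensional ℝ (EuclideanSpace ℝ (Fin m)))

theorem finrank_tangentSpace (x : M) : Module.finrank ℝ (TangentSpace (𝓡 m) x) = m :=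
  finrank_euclideanSpace_fin

variable [RiemannianBundle (fun x : M ↦ TangentSpace (𝓡 m) x)]

theorem sum_inner_smul_tangent {x : M} {v : Fin m → TangentSpace (𝓡 m) x} (hv : Orthonormal ℝ v)
    (u : TangentSpace (𝓡 m) x) : ∑ i, inner ℝ (v i) u • v i = u :=
  have := finiteDimensional_tangentSpace (m := m) x
  sum_inner_smul_of_orthonormal hv (by rw [finrank_tangentSpace]; simp) u

end TangentFrame

/-! ### Riemannian submersions -/

section Submersion

open Set Filter Topology VectorField

variable {m n : ℕ}
  {M : Type*} [TopologicalSpace M] [ChartedSpace (EuclideanSpace ℝ (Fin m)) M]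
  [IsManifold (𝓡 m) ∞ M]
  {N : Type*} [TopologicalSpace N] [ChartedSpace (EuclideanSpace ℝ (Fin n)) N]
  [IsManifold (𝓡 n) ∞ N]

/-- A submersion is an open map. -/
theorem isOpenMap_of_surjective_mfderiv {φ : M → N} (hφ : ContMDiff (𝓡 m) (𝓡 n) ∞ φ)
    (hsurj : ∀ p, Function.Surjective (mfderiv (𝓡 m) (𝓡 n) φ p)) : IsOpenMap φ := by
  intro U hU
  rw [isOpen_iff_mem_nhds]
  rintro _ ⟨p, hp, rfl⟩
  set Φ : EuclideanSpace ℝ (Fin m) → EuclideanSpace ℝ (Fin n) :=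
    writtenInExtChartAt (𝓡 m) (𝓡 n) p φ with hΦdef
  set y : EuclideanSpace ℝ (Fin m) := extChartAt (𝓡 m) p p with hydef
  set S := coordDomain (m := m) p (U ∩ φ ⁻¹' (extChartAt (𝓡 n) (φ p)).source) with hS
  have hSo : IsOpen S :=
    isOpen_coordDomain p (hU.inter ((isOpen_extChartAt_source _).preimage hφ.continuous))
  have hyS : y ∈ S := mem_coordDomain ⟨hp, mem_extChartAt_source (I := 𝓡 n) (φ p)⟩
  have hy := mem_coordDomain_preimage_source (m := m) (n := n) φ p
  have hΦy : Φ y = extChartAt (𝓡 n) (φ p) (φ p) := by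
    simp [hΦdef, hydef, writtenInExtChartAt]
  have hΦt : Φ y ∈ (extChartAt (𝓡 n) (φ p)).target := by
    rw [hΦy]; exact mem_extChartAt_target (φ p)
  have hcd : ContDiffAt ℝ ∞ Φ y := contDiffAt_writtenInExtChartAt hφ hy
  have hstrict : HasStrictFDerivAt Φ (fderiv ℝ Φ y) y := hcd.hasStrictFDerivAt (by simp)
  have hrange : (fderiv ℝ Φ y).range = ⊤ := by
    rw [LinearMap.range_eq_top]
    intro v
    obtain ⟨w, hw⟩ := hsurj ((extChartAt (𝓡 m) p).symm y)
      (coordDeriv (φ p) (Φ y) v : EuclideanSpace ℝ (Fin n))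
    obtain ⟨u, rfl⟩ := (isInvertible_coordDeriv hy.1).surjective w
    refine ⟨u, (isInvertible_coordDeriv hΦt).injective ?_⟩
    exact (coordDeriv_fderiv_writtenInExtChartAt hφ hy u).symm.trans hw
  -- A strictly differentiable map with onto derivative carries neighbourhoods to neighbourhoods.
  have hmap : Φ '' S ∈ 𝓝 (extChartAt (𝓡 n) (φ p) (φ p)) := by
    rw [← hΦy, ← hstrict.map_nhds_eq_of_surj hrange]
    exact image_mem_map (hSo.mem_nhds hyS)
  filter_upwards [(continuousAt_extChartAt (I := 𝓡 n) (φ p)).preimage_mem_nhds hmap,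
    extChartAt_source_mem_nhds (I := 𝓡 n) (φ p)] with q hq hqs
  obtain ⟨z, hz, hzq⟩ := hq
  refine ⟨(extChartAt (𝓡 m) p).symm z, hz.2.1, ?_⟩
  exact (extChartAt (𝓡 n) (φ p)).injOn hz.2.2 hqs hzq

/-- Brackets of `φ`-related vector fields are `φ`-related. -/
theorem mfderiv_mlieBracket_of_related {φ : M → N} (hφ : ContMDiff (𝓡 m) (𝓡 n) ∞ φ) {U : Set M}
    (hU : IsOpen U) (hφU : IsOpen (φ '' U)) {V₁ V₂ : (x : M) → TangentSpace (𝓡 m) x}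
    {W₁ W₂ : (x : N) → TangentSpace (𝓡 n) x}
    (hV₁ : ContMDiffOn (𝓡 m) (𝓡 m).tangent ∞ (fun x ↦ (⟨x, V₁ x⟩ : TangentBundle (𝓡 m) M)) U)
    (hV₂ : ContMDiffOn (𝓡 m) (𝓡 m).tangent ∞ (fun x ↦ (⟨x, V₂ x⟩ : TangentBundle (𝓡 m) M)) U)
    (hW₁ : ContMDiffOn (𝓡 n) (𝓡 n).tangent ∞ (fun x ↦ (⟨x, W₁ x⟩ : TangentBundle (𝓡 n) N))
      (φ '' U))
    (hW₂ : ContMDiffOn (𝓡 n) (𝓡 n).tangent ∞ (fun x ↦ (⟨x, W₂ x⟩ : TangentBundle (𝓡 n) N))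
      (φ '' U))
    (h₁ : ∀ x ∈ U, mfderiv (𝓡 m) (𝓡 n) φ x (V₁ x) = W₁ (φ x))
    (h₂ : ∀ x ∈ U, mfderiv (𝓡 m) (𝓡 n) φ x (V₂ x) = W₂ (φ x)) {p : M} (hp : p ∈ U) :
    mfderiv (𝓡 m) (𝓡 n) φ p (mlieBracket (𝓡 m) V₁ V₂ p) = mlieBracket (𝓡 n) W₁ W₂ (φ p) := by
  set Φ : EuclideanSpace ℝ (Fin m) → EuclideanSpace ℝ (Fin n) :=
    writtenInExtChartAt (𝓡 m) (𝓡 n) p φ with hΦdef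
  set y : EuclideanSpace ℝ (Fin m) := extChartAt (𝓡 m) p p with hydef
  have hy := mem_coordDomain_preimage_source (m := m) (n := n) φ p
  have hyU : y ∈ coordDomain p U := mem_coordDomain hp
  have hΦy : Φ y ∈ coordDomain (φ p) (φ '' U) := by
    have : Φ y = extChartAt (𝓡 n) (φ p) (φ p) := by simp [hΦdef, hydef, writtenInExtChartAt]
    rw [this]
    exact mem_coordDomain (mem_image_of_mem φ hp)
  have hrel : ∀ {V : (x : M) → TangentSpace (𝓡 m) x} {W : (x : N) → TangentSpace (𝓡 n) x},
      (∀ x ∈ U, mfderiv (𝓡 m) (𝓡 n) φ x (V x) = W (φ x)) →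
      ∀ᶠ z in 𝓝 y, fderiv ℝ Φ z (coordField p V z) = coordField (φ p) W (Φ z) := by
    intro V W h
    have hopen : IsOpen (coordDomain (m := m) p (φ ⁻¹' (extChartAt (𝓡 n) (φ p)).source)) :=
      isOpen_coordDomain p ((isOpen_extChartAt_source _).preimage hφ.continuous)
    filter_upwards [hopen.mem_nhds hy, (isOpen_coordDomain p hU).mem_nhds hyU] with z hz hzU
    exact (fderiv_coordField_iff hφ hz).2 (h _ hzU.2)
  have hVd : ∀ {V : (x : M) → TangentSpace (𝓡 m) x},
      ContMDiffOn (𝓡 m) (𝓡 m).tangent ∞ (fun x ↦ (⟨x, V x⟩ : TangentBundle (𝓡 m) M)) U →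
      DifferentiableAt ℝ (coordField p V) y := fun hV ↦ ((contDiffOn_coordField p hU hV).contDiffAt
      ((isOpen_coordDomain p hU).mem_nhds hyU)).differentiableAt (by simp)
  have hWd : ∀ {W : (x : N) → TangentSpace (𝓡 n) x},
      ContMDiffOn (𝓡 n) (𝓡 n).tangent ∞ (fun x ↦ (⟨x, W x⟩ : TangentBundle (𝓡 n) N)) (φ '' U) →
      DifferentiableAt ℝ (coordField (φ p) W) (Φ y) := fun hW ↦
      ((contDiffOn_coordField (φ p) hφU hW).contDiffAt
      ((isOpen_coordDomain (φ p) hφU).mem_nhds hΦy)).differentiableAt (by simp)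
  have h := fderiv_lieBracket_of_related ((contDiffAt_writtenInExtChartAt hφ hy).of_le
    (WithTop.coe_le_coe.2 le_top)) (hVd hV₁) (hVd hV₂) (hWd hW₁) (hWd hW₂) (hrel h₁) (hrel h₂)
  rw [← coordField_mlieBracket hU hV₁ hV₂ hyU, ← coordField_mlieBracket hφU hW₁ hW₂ hΦy,
    fderiv_coordField_iff hφ hy] at h
  have hp' : (extChartAt (𝓡 m) p).symm y = p := extChartAt_to_inv p
  rwa [hp'] at h

end Submersion

/-! ### Adapted frames -/

section Adapted

open Set Filter Topology VectorField

variable {n : ℕ}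
  {M : Type*} [TopologicalSpace M] [ChartedSpace (EuclideanSpace ℝ (Fin (n + 1))) M]
  [IsManifold (𝓡 (n + 1)) ∞ M]
  [RiemannianBundle (fun x : M ↦ TangentSpace (𝓡 (n + 1)) x)]
  {N : Type*} [TopologicalSpace N] [ChartedSpace (EuclideanSpace ℝ (Fin n)) N]
  [IsManifold (𝓡 n) ∞ N]
  [RiemannianBundle (fun x : N ↦ TangentSpace (𝓡 n) x)]
  {φ : M → N} {U : Set M}
  {e : Fin (n + 1) → (x : M) → TangentSpace (𝓡 (n + 1)) x}
  {ε : Fin n → (y : N) → TangentSpace (𝓡 n) y}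

namespace IsAdaptedFrame

theorem mfderiv_last (he : IsAdaptedFrame φ U e ε) {x : M} (hx : x ∈ U) :
    mfderiv (𝓡 (n + 1)) (𝓡 n) φ x (e (Fin.last n) x) = 0 :=
  LinearMap.mem_ker.1 (he.vertical x hx)

theorem sum_inner_smul (he : IsAdaptedFrame φ U e ε) {x : M} (hx : x ∈ U)
    (u : TangentSpace (𝓡 (n + 1)) x) :
    ∑ i : Fin n, inner ℝ (e i.castSucc x) u • e i.castSucc x
      + inner ℝ (e (Fin.last n) x) u • e (Fin.last n) x = u := by
  have := sum_inner_smul_tangent (he.orthonormal x hx) u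
  rwa [Fin.sum_univ_castSucc] at this

theorem mfderiv_eq_sum (he : IsAdaptedFrame φ U e ε) {x : M} (hx : x ∈ U)
    (u : TangentSpace (𝓡 (n + 1)) x) :
    mfderiv (𝓡 (n + 1)) (𝓡 n) φ x u = ∑ i : Fin n, inner ℝ (e i.castSucc x) u • ε i (φ x) := by
  nth_rw 1 [← he.sum_inner_smul hx u]
  rw [map_add, map_sum, map_smul, he.mfderiv_last hx, smul_zero, add_zero]
  exact Finset.sum_congr rfl fun i _ ↦ by rw [map_smul, he.related i x hx]

theorem inner_eq_inner_mfderiv (he : IsAdaptedFrame φ U e ε) {x : M} (hx : x ∈ U) (i : Fin n)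
    (u : TangentSpace (𝓡 (n + 1)) x) :
    inner ℝ (e i.castSucc x) u = inner ℝ (ε i (φ x)) (mfderiv (𝓡 (n + 1)) (𝓡 n) φ x u) := by
  rw [he.mfderiv_eq_sum hx, (he.orthonormal_base _ (mem_image_of_mem φ hx)).inner_right_fintype]

theorem mem_verticalSpace_iff (he : IsAdaptedFrame φ U e ε) {x : M} (hx : x ∈ U)
    {u : TangentSpace (𝓡 (n + 1)) x} :
    u ∈ verticalSpace (n + 1) n φ x ↔
      u = inner ℝ (e (Fin.last n) x) u • e (Fin.last n) x := by
  constructor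
  · intro hu
    have hu' : mfderiv (𝓡 (n + 1)) (𝓡 n) φ x u = 0 := LinearMap.mem_ker.1 hu
    nth_rw 1 [← he.sum_inner_smul hx u]
    rw [Finset.sum_eq_zero, zero_add]
    intro i _
    rw [he.inner_eq_inner_mfderiv hx, hu', inner_zero_right, zero_smul]
  · intro hu
    rw [hu]
    exact Submodule.smul_mem _ _ (he.vertical x hx)

theorem mem_horizontalSpace_iff (he : IsAdaptedFrame φ U e ε) {x : M} (hx : x ∈ U)
    {u : TangentSpace (𝓡 (n + 1)) x} :
    u ∈ horizontalSpace (n + 1) n φ x ↔ inner ℝ (e (Fin.last n) x) u = 0 := by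
  rw [horizontalSpace, Submodule.mem_orthogonal]
  refine ⟨fun h ↦ h _ (he.vertical x hx), fun h v hv ↦ ?_⟩
  rw [(he.mem_verticalSpace_iff hx).1 hv, real_inner_smul_left, h, mul_zero]

/-- The coefficients are inner products of brackets with frame fields, smooth because the metrics
are. Relatedness shows that [e_i, e_{n+1}] is vertical and that the horizontal coefficients of [e_i,
e_j] factor through φ. -/
theorem exists_integrabilityData
    [IsContMDiffRiemannianBundle (𝓡 (n + 1)) ∞ (EuclideanSpace ℝ (Fin (n + 1)))
      (fun x : M ↦ TangentSpace (𝓡 (n + 1)) x)]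
    [IsContMDiffRiemannianBundle (𝓡 n) ∞ (EuclideanSpace ℝ (Fin n))
      (fun y : N ↦ TangentSpace (𝓡 n) y)]
    (he : IsAdaptedFrame φ U e ε) (hφ : ContMDiff (𝓡 (n + 1)) (𝓡 n) ∞ φ) (hU : IsOpen U)
    (hφU : IsOpen (φ '' U)) : ∃ f κ σ, IsIntegrabilityData φ U e ε f κ σ := by
  have hbrM : ∀ a b, ContMDiffOn (𝓡 (n + 1)) (𝓡 (n + 1)).tangent ∞
      (fun x ↦ (⟨x, mlieBracket (𝓡 (n + 1)) (e a) (e b) x⟩ : TangentBundle (𝓡 (n + 1)) M)) U := by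
    intro a b x hx
    have : IsManifold (𝓡 (n + 1)) (((⊤ : ℕ∞) : WithTop ℕ∞) + 1) M := by simpa
    have := isManifold_minSmoothness_two (m := n + 1) (M := M)
    exact (ContMDiffAt.mlieBracket_vectorField (m := ⊤) (n := ⊤)
      ((he.smooth a).contMDiffAt (hU.mem_nhds hx)) ((he.smooth b).contMDiffAt (hU.mem_nhds hx))
      (by simp)).contMDiffWithinAt
  have hbrN : ∀ i j, ContMDiffOn (𝓡 n) (𝓡 n).tangent ∞
      (fun x ↦ (⟨x, mlieBracket (𝓡 n) (ε i) (ε j) x⟩ : TangentBundle (𝓡 n) N)) (φ '' U) := by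
    intro i j x hx
    have : IsManifold (𝓡 n) (((⊤ : ℕ∞) : WithTop ℕ∞) + 1) N := by simpa
    have := isManifold_minSmoothness_two (m := n) (M := N)
    exact (ContMDiffAt.mlieBracket_vectorField (m := ⊤) (n := ⊤)
      ((he.smooth_base i).contMDiffAt (hφU.mem_nhds hx))
      ((he.smooth_base j).contMDiffAt (hφU.mem_nhds hx)) (by simp)).contMDiffWithinAt
  let F : Fin n → Fin n → Fin n → N → ℝ := fun i j k y ↦
    inner ℝ (ε k y) (mlieBracket (𝓡 n) (ε i) (ε j) y)
  let κ : Fin n → M → ℝ := fun i x ↦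
    inner ℝ (e (Fin.last n) x) (mlieBracket (𝓡 (n + 1)) (e i.castSucc) (e (Fin.last n)) x)
  -- The factor -1/2 matches the normalisation -2σ in the bracket.
  let σ : Fin n → Fin n → M → ℝ := fun i j x ↦ (-1 / 2 : ℝ) *
    inner ℝ (e (Fin.last n) x) (mlieBracket (𝓡 (n + 1)) (e i.castSucc) (e j.castSucc) x)
  have hzero : ContMDiffOn (𝓡 n) (𝓡 n).tangent ∞
      (fun x ↦ (⟨x, (0 : (x : N) → TangentSpace (𝓡 n) x) x⟩ : TangentBundle (𝓡 n) N)) (φ '' U) :=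
    (Bundle.contMDiff_zeroSection ℝ (TangentSpace (𝓡 n) : N → Type _)).contMDiffOn
  refine ⟨fun i j k x ↦ F i j k (φ x), κ, σ, ⟨F, fun i j k ↦ ?_, fun i j y hy ↦ ?_,
    fun _ _ _ _ _ ↦ rfl⟩, fun i ↦ ?_, fun i j ↦ ?_, fun i x hx ↦ ?_, fun i j x hx ↦ ?_⟩
  · exact ContMDiffOn.inner_bundle (he.smooth_base k) (hbrN i j)
  · exact (sum_inner_smul_tangent (he.orthonormal_base y hy) _).symm
  · exact ContMDiffOn.inner_bundle (he.smooth (Fin.last n)) (hbrM _ _)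
  · exact contMDiffOn_const.mul (ContMDiffOn.inner_bundle (he.smooth (Fin.last n)) (hbrM _ _))
  · refine (he.mem_verticalSpace_iff hx).1 (LinearMap.mem_ker.2 ?_)
    refine (mfderiv_mlieBracket_of_related hφ hU hφU (he.smooth i.castSucc)
      (he.smooth (Fin.last n)) (he.smooth_base i) hzero (he.related i)
      (fun x hx ↦ he.mfderiv_last hx) hx).trans ?_
    rw [mlieBracket_zero_right]
    rfl
  · nth_rw 1 [← he.sum_inner_smul hx (mlieBracket (𝓡 (n + 1)) (e i.castSucc) (e j.castSucc) x)]
    rw [sub_eq_add_neg, ← neg_smul]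
    congr 1
    · refine Finset.sum_congr rfl fun k _ ↦ ?_
      rw [he.inner_eq_inner_mfderiv hx, mfderiv_mlieBracket_of_related hφ hU hφU
        (he.smooth i.castSucc) (he.smooth j.castSucc) (he.smooth_base i) (he.smooth_base j)
        (he.related i) (he.related j) hx]
    · congr 1
      simp only [σ]
      ring

end IsAdaptedFrame

end Adapted

/-! ### Integrability data, flatness, integrability and harmonicity -/

theorem finrank_horizontalSpace {n : ℕ}
    {M : Type*} [TopologicalSpace M] [ChartedSpace (EuclideanSpace ℝ (Fin (n + 1))) M]
    [RiemannianBundle (fun x : M ↦ TangentSpace (𝓡 (n + 1)) x)]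
    {N : Type*} [TopologicalSpace N] [ChartedSpace (EuclideanSpace ℝ (Fin n)) N]
    {φ : M → N} {p : M}
    (hsurj : Function.Surjective (mfderiv (𝓡 (n + 1)) (𝓡 n) φ p)) :
    Module.finrank ℝ (horizontalSpace (n + 1) n φ p) = n := by
  have := finiteDimensional_tangentSpace (m := n + 1) p
  have h1 := (mfderiv (𝓡 (n + 1)) (𝓡 n) φ p).toLinearMap.finrank_range_add_finrank_ker
  rw [LinearMap.range_eq_top.2 hsurj, finrank_top, finrank_tangentSpace, finrank_tangentSpace] at h1
  have h2 := (verticalSpace (n + 1) n φ p).finrank_add_finrank_orthogonal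
  rw [finrank_tangentSpace] at h2
  change n + Module.finrank ℝ (verticalSpace (n + 1) n φ p) = n + 1 at h1
  change Module.finrank ℝ (verticalSpace (n + 1) n φ p) +
    Module.finrank ℝ (horizontalSpace (n + 1) n φ p) = n + 1 at h2
  have hv : Module.finrank ℝ (verticalSpace (n + 1) n φ p) = 1 := Nat.add_left_cancel h1
  rw [hv, add_comm] at h2
  exact Nat.add_right_cancel h2

section IntegrabilityData

open Set Filter Topology VectorField

variable {n : ℕ}
  {M : Type*} [TopologicalSpace M] [ChartedSpace (EuclideanSpace ℝ (Fin (n + 1))) M]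
  [IsManifold (𝓡 (n + 1)) ∞ M]
  [RiemannianBundle (fun x : M ↦ TangentSpace (𝓡 (n + 1)) x)]
  {N : Type*} [TopologicalSpace N] [ChartedSpace (EuclideanSpace ℝ (Fin n)) N]
  [IsManifold (𝓡 n) ∞ N]
  [RiemannianBundle (fun x : N ↦ TangentSpace (𝓡 n) x)]
  {φ : M → N} {U : Set M}
  {e : Fin (n + 1) → (x : M) → TangentSpace (𝓡 (n + 1)) x}
  {ε : Fin n → (y : N) → TangentSpace (𝓡 n) y}
  {f : Fin n → Fin n → Fin n → M → ℝ} {κ : Fin n → M → ℝ} {σ : Fin n → Fin n → M → ℝ}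

namespace IsAdaptedFrame

theorem exists_isDualFrame (he : IsAdaptedFrame φ U e ε) (hU : IsOpen U) (p : M) :
    ∃ θ, IsDualFrame (coordDomain p U) (fun a ↦ coordField p (e a)) θ :=
  exists_isDualFrame_coordField p hU he.smooth fun x hx ↦ (he.orthonormal x hx).linearIndependent

theorem exists_isDualFrame_base (he : IsAdaptedFrame φ U e ε) (hφU : IsOpen (φ '' U)) (q : N) :
    ∃ η, IsDualFrame (coordDomain q (φ '' U)) (fun i ↦ coordField q (ε i)) η :=
  exists_isDualFrame_coordField q hφU he.smooth_base
    fun y hy ↦ (he.orthonormal_base y hy).linearIndependent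

variable {p : M} {y : EuclideanSpace ℝ (Fin (n + 1))}
  {θ : Fin (n + 1) → EuclideanSpace ℝ (Fin (n + 1)) → EuclideanSpace ℝ (Fin (n + 1)) →L[ℝ] ℝ}

/-- In the chart θ_{n+1} is the form g(e_{n+1}, ·), so the horizontal distribution is its kernel. -/
theorem dual_last_eq_zero_iff (he : IsAdaptedFrame φ U e ε)
    (hθ : IsDualFrame (coordDomain p U) (fun a ↦ coordField p (e a)) θ)
    (hy : y ∈ coordDomain p U) (u : EuclideanSpace ℝ (Fin (n + 1))) :
    θ (Fin.last n) y u = 0 ↔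
      coordDeriv p y u ∈ horizontalSpace (n + 1) n φ ((extChartAt (𝓡 (n + 1)) p).symm y) := by
  rw [he.mem_horizontalSpace_iff hy.2]
  have h : coordDeriv p y u = ∑ a, θ a y u • e a ((extChartAt (𝓡 (n + 1)) p).symm y) := by
    nth_rw 1 [← hθ.sum_smul y hy u]
    rw [map_sum]
    exact Finset.sum_congr rfl fun a _ ↦ by rw [map_smul, coordDeriv_coordField hy.1]
  rw [h, (he.orthonormal _ hy.2).inner_right_fintype]

theorem lieBracket_vertical (he : IsAdaptedFrame φ U e ε) (hU : IsOpen U)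
    (hd : IsIntegrabilityData φ U e ε f κ σ) (hy : y ∈ coordDomain p U) (i : Fin n) :
    lieBracket ℝ (coordField p (e i.castSucc)) (coordField p (e (Fin.last n))) y =
      κ i ((extChartAt (𝓡 (n + 1)) p).symm y) • coordField p (e (Fin.last n)) y := by
  rw [← coordField_mlieBracket hU (he.smooth _) (he.smooth _) hy]
  refine coordField_eq_of_coordDeriv hy.1 ?_
  rw [map_smul, coordDeriv_coordField hy.1, hd.bracket_vertical i _ hy.2]

theorem dual_last_lieBracket (he : IsAdaptedFrame φ U e ε) (hU : IsOpen U)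
    (hd : IsIntegrabilityData φ U e ε f κ σ)
    (hθ : IsDualFrame (coordDomain p U) (fun a ↦ coordField p (e a)) θ)
    (hy : y ∈ coordDomain p U) (i j : Fin n) :
    θ (Fin.last n) y
      (lieBracket ℝ (coordField p (e i.castSucc)) (coordField p (e j.castSucc)) y) =
      -2 * σ i j ((extChartAt (𝓡 (n + 1)) p).symm y) := by
  have h : lieBracket ℝ (coordField p (e i.castSucc)) (coordField p (e j.castSucc)) y =
      ∑ k : Fin n, f i j k ((extChartAt (𝓡 (n + 1)) p).symm y) • coordField p (e k.castSucc) y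
        - (2 * σ i j ((extChartAt (𝓡 (n + 1)) p).symm y)) • coordField p (e (Fin.last n)) y := by
    rw [← coordField_mlieBracket hU (he.smooth _) (he.smooth _) hy]
    refine coordField_eq_of_coordDeriv hy.1 ?_
    rw [hd.bracket_horizontal i j _ hy.2, map_sub, map_sum, map_smul, coordDeriv_coordField hy.1]
    congr 1
    exact Finset.sum_congr rfl fun k _ ↦ by rw [map_smul, coordDeriv_coordField hy.1]
  rw [h, map_sub, map_sum, map_smul, hθ.dual y hy, if_pos rfl, Finset.sum_eq_zero]
  · simp
  · intro k _
    rw [map_smul, hθ.dual y hy, if_neg (Fin.castSucc_lt_last k).ne', smul_zero]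

/-- At each point the components of τ(φ) in the frame ε are -κ_k, so the equivalence already holds
pointwise. -/
theorem isHarmonicOn_iff (he : IsAdaptedFrame φ U e ε) (hφ : ContMDiff (𝓡 (n + 1)) (𝓡 n) ∞ φ)
    (hU : IsOpen U) (hφU : IsOpen (φ '' U)) (hd : IsIntegrabilityData φ U e ε f κ σ) :
    (∀ i, ∀ x ∈ U, κ i x = 0) ↔ IsHarmonicOn (n + 1) n φ U := by
  have key : ∀ p ∈ U, (∀ i, κ i p = 0) ↔ tensionField (n + 1) n φ p = 0 := by
    intro p hp
    obtain ⟨θ, hθ⟩ := he.exists_isDualFrame hU p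
    obtain ⟨η, hη⟩ := he.exists_isDualFrame_base hφU (φ p)
    have hyU : extChartAt (𝓡 (n + 1)) p p ∈ coordDomain p U := mem_coordDomain hp
    have hy := mem_coordDomain_preimage_source (m := n + 1) (n := n) φ p
    have hy' : extChartAt (𝓡 n) (φ p) (φ p) ∈ coordDomain (φ p) (φ '' U) :=
      mem_coordDomain (mem_image_of_mem φ hp)
    have hnhds : coordDomain p U ∩ coordDomain p (φ ⁻¹' (extChartAt (𝓡 n) (φ p)).source) ∈
        𝓝 (extChartAt (𝓡 (n + 1)) p p) :=
      inter_mem ((isOpen_coordDomain p hU).mem_nhds hyU)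
        ((isOpen_coordDomain p ((isOpen_extChartAt_source _).preimage hφ.continuous)).mem_nhds hy)
    have hver : ∀ᶠ z in 𝓝 (extChartAt (𝓡 (n + 1)) p p),
        fderiv ℝ (writtenInExtChartAt (𝓡 (n + 1)) (𝓡 n) p φ) z
          (coordField p (e (Fin.last n)) z) = 0 := by
      filter_upwards [hnhds] with z hz
      refine ((fderiv_coordField_iff (W := 0) hφ hz.2).2 (he.mfderiv_last hz.1.2)).trans ?_
      refine coordField_eq_of_coordDeriv ((extChartAt (𝓡 n) (φ p)).map_source hz.2.2) ?_
      rw [map_zero]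
      rfl
    have hτ := dual_tensionField ((contDiffAt_writtenInExtChartAt hφ hy).of_le
      (WithTop.coe_le_coe.2 le_top)) hθ (isDualMetric_of_orthonormal he.orthonormal hθ) hyU hη
      (isDualMetric_of_orthonormal he.orthonormal_base hη) hy' (fun i ↦ by
        filter_upwards [hnhds] with z hz
        exact (fderiv_coordField_iff hφ hz.2).2 (he.related i _ hz.1.2)) hver
    have hτ' : ∀ k, η k (extChartAt (𝓡 n) (φ p) (φ p))
        (tensionField (n + 1) n φ p : EuclideanSpace ℝ (Fin n)) = -κ k p := by
      intro k
      rw [hτ k, he.lieBracket_vertical hU hd hyU, map_smul, hθ.dual _ hyU, if_pos rfl,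
        extChartAt_to_inv, smul_eq_mul, mul_one]
    constructor
    · intro h
      refine hη.eq_of_dual_eq hy' (v := 0) fun k ↦ ?_
      rw [hτ', h, map_zero, neg_zero]
    · intro h k
      rw [← neg_eq_zero, ← hτ' k, h]
      exact map_zero _
  exact ⟨fun h p hp ↦ (key p hp).1 fun i ↦ h i p hp, fun h i x hx ↦ (key x hx).2 (h x hx) i⟩

/-- With σ = 0, dθ_{n+1} vanishes on ker θ_{n+1}; the integral manifold found in the chart is
carried to M by the inverse chart. -/
theorem isIntegrableOn_of_forall_eq_zero (he : IsAdaptedFrame φ U e ε)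
    (hsurj : ∀ p, Function.Surjective (mfderiv (𝓡 (n + 1)) (𝓡 n) φ p)) (hU : IsOpen U)
    (hd : IsIntegrabilityData φ U e ε f κ σ) (hσ : ∀ i j, ∀ x ∈ U, σ i j x = 0) :
    IsIntegrableOn n (horizontalSpace (n + 1) n φ) U := by
  intro p hp
  obtain ⟨θ, hθ⟩ := he.exists_isDualFrame hU p
  have hy : extChartAt (𝓡 (n + 1)) p p ∈ coordDomain p U := mem_coordDomain hp
  have hlast : ∀ y ∈ coordDomain p U, ∀ i : Fin n,
      θ (Fin.last n) y (coordField p (e i.castSucc) y) = 0 := fun y hy i ↦ by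
    rw [hθ.dual y hy, if_neg (Fin.castSucc_lt_last i).ne']
  have hinj : ∀ y ∈ coordDomain p U,
      Function.Injective (frameMap (fun i : Fin n ↦ coordField p (e i.castSucc)) y) := by
    intro y hy
    rw [injective_iff_map_eq_zero]
    intro u hu
    ext i
    have h := congrArg (θ i.castSucc y) hu
    simpa [frameMap_apply, hθ.dual _ hy] using h
  have hker : ∀ y ∈ coordDomain p U, ∀ u,
      θ (Fin.last n) y (frameMap (fun i : Fin n ↦ coordField p (e i.castSucc)) y u) = 0 := by
    intro y hy u
    simp [frameMap_apply, hlast _ hy]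
  -- The transverse vector is e_{n+1} at p, and J spans the horizontal space there.
  obtain ⟨W, ψ, hW, h0, hψ0, hmaps, hψs, hψ⟩ := exists_integral_of_fderiv_symm
    (θ := θ (Fin.last n)) (V := coordField p (e (Fin.last n)) (extChartAt (𝓡 (n + 1)) p p))
    (J := frameMap (fun i : Fin n ↦ coordField p (e i.castSucc)) (extChartAt (𝓡 (n + 1)) p p))
    (isOpen_coordDomain p hU) hy (hθ.smooth_dual _)
    (fun y hy u v hu hv ↦ hθ.fderiv_dual_symm hy (fun a b ha hb ↦ by
      obtain ⟨i, rfl⟩ := Fin.exists_castSucc_eq.2 ha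
      obtain ⟨j, rfl⟩ := Fin.exists_castSucc_eq.2 hb
      rw [he.dual_last_lieBracket hU hd hθ hy, hσ i j _ hy.2, mul_zero]) hu hv)
    (by rw [hθ.dual _ hy, if_pos rfl]; exact one_ne_zero)
    (hinj _ hy) (hker _ hy)
  have hmf : ∀ w ∈ W, ∀ u : EuclideanSpace ℝ (Fin n),
      mfderiv (𝓡 n) (𝓡 (n + 1)) ((extChartAt (𝓡 (n + 1)) p).symm ∘ ψ) w u =
        coordDeriv p (ψ w) (fderiv ℝ ψ w u) := fun w hw u ↦
    mfderiv_eq_coordDeriv_fderiv ((hψs.contDiffAt (hW.mem_nhds hw)).differentiableAt (by simp))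
      (hmaps hw).1 .rfl u
  refine ⟨W, (extChartAt (𝓡 (n + 1)) p).symm ∘ ψ, hW, h0, ?_, fun w hw ↦ (hmaps hw).2, ?_,
    fun w hw ↦ ?_⟩
  · rw [Function.comp_apply, hψ0, extChartAt_to_inv]
  · exact (contMDiffOn_extChartAt_symm p).comp hψs.contMDiffOn fun w hw ↦ (hmaps hw).1
  · have hinj : Function.Injective
        (mfderiv (𝓡 n) (𝓡 (n + 1)) ((extChartAt (𝓡 (n + 1)) p).symm ∘ ψ) w) := by
      intro u v huv
      refine (hψ w hw).1 ((isInvertible_coordDeriv (hmaps hw).1).injective ?_)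
      exact (hmf w hw u).symm.trans (huv.trans (hmf w hw v))
    refine ⟨hinj, ?_⟩
    have := finiteDimensional_tangentSpace (m := n + 1)
      (((extChartAt (𝓡 (n + 1)) p).symm ∘ ψ) w)
    -- The tangent space is contained in the horizontal space, and both have dimension n.
    refine Submodule.eq_of_le_of_finrank_eq ?_ ?_
    · rintro _ ⟨u, rfl⟩
      change mfderiv (𝓡 n) (𝓡 (n + 1)) ((extChartAt (𝓡 (n + 1)) p).symm ∘ ψ) w u ∈ _
      rw [hmf w hw u]
      exact (he.dual_last_eq_zero_iff hθ (hmaps hw) _).1 ((hψ w hw).2 u)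
    · rw [finrank_horizontalSpace (hsurj _)]
      exact (LinearMap.finrank_range_of_inj hinj).trans (finrank_tangentSpace (m := n) w)

/-- On the integral manifold through p the form dθ_{n+1} vanishes, and the tangent space at p
contains every e_i; evaluating on e_i, e_j gives σ_{ij}(p) = 0. -/
theorem forall_eq_zero_of_isIntegrableOn (he : IsAdaptedFrame φ U e ε) (hU : IsOpen U)
    (hd : IsIntegrabilityData φ U e ε f κ σ)
    (hint : IsIntegrableOn n (horizontalSpace (n + 1) n φ) U) :
    ∀ i j, ∀ x ∈ U, σ i j x = 0 := by
  intro i j p hp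
  obtain ⟨W, ψ, hW, h0, hψ0, hmaps, hψs, hψ⟩ := hint p hp
  obtain ⟨θ, hθ⟩ := he.exists_isDualFrame hU p
  have hy : extChartAt (𝓡 (n + 1)) p p ∈ coordDomain p U := mem_coordDomain hp
  set Ψ : EuclideanSpace ℝ (Fin n) → EuclideanSpace ℝ (Fin (n + 1)) :=
    extChartAt (𝓡 (n + 1)) p ∘ ψ with hΨdef
  have hΨ0 : Ψ 0 = extChartAt (𝓡 (n + 1)) p p := by rw [hΨdef, Function.comp_apply, hψ0]
  set W' := W ∩ ψ ⁻¹' (extChartAt (𝓡 (n + 1)) p).source with hW'def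
  have hW' : IsOpen W' := hψs.continuousOn.isOpen_inter_preimage hW (isOpen_extChartAt_source p)
  have h0' : (0 : EuclideanSpace ℝ (Fin n)) ∈ W' :=
    ⟨h0, by rw [mem_preimage, hψ0]; exact mem_extChartAt_source p⟩
  have hinv : ∀ w ∈ W', (extChartAt (𝓡 (n + 1)) p).symm (Ψ w) = ψ w := fun w hw ↦
    (extChartAt (𝓡 (n + 1)) p).left_inv hw.2
  have hdom : ∀ w ∈ W', Ψ w ∈ coordDomain p U := fun w hw ↦
    ⟨(extChartAt (𝓡 (n + 1)) p).map_source hw.2, by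
      rw [mem_preimage, hinv w hw]; exact hmaps hw.1⟩
  have hΨs : ∀ w ∈ W', ContDiffAt ℝ ∞ Ψ w := by
    intro w hw
    rw [← contMDiffAt_iff_contDiffAt]
    exact (contMDiffAt_extChartAt' (by simpa using hw.2)).comp w
      (hψs.contMDiffAt (hW.mem_nhds hw.1))
  have hmf : ∀ w ∈ W', ∀ u : EuclideanSpace ℝ (Fin n),
      (mfderiv (𝓡 n) (𝓡 (n + 1)) ψ w u : EuclideanSpace ℝ (Fin (n + 1))) =
        coordDeriv p (Ψ w) (fderiv ℝ Ψ w u) := fun w hw u ↦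
    mfderiv_eq_coordDeriv_fderiv ((hΨs w hw).differentiableAt (by simp)) (hdom w hw).1
      (by filter_upwards [hW'.mem_nhds hw] with z hz using hinv z hz) u
  -- statements about the fibre at `ψ w`, transported to the base point used by the chart
  have hmem : ∀ w ∈ W', ∀ v : TangentSpace (𝓡 (n + 1)) ((extChartAt (𝓡 (n + 1)) p).symm (Ψ w)),
      v ∈ horizontalSpace (n + 1) n φ ((extChartAt (𝓡 (n + 1)) p).symm (Ψ w)) ↔
        ∃ u : EuclideanSpace ℝ (Fin n),
          (mfderiv (𝓡 n) (𝓡 (n + 1)) ψ w u : EuclideanSpace ℝ (Fin (n + 1))) = v := by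
    intro w hw
    have h : ∀ x, x = ψ w → ∀ v : TangentSpace (𝓡 (n + 1)) x,
        v ∈ horizontalSpace (n + 1) n φ x ↔ ∃ u : EuclideanSpace ℝ (Fin n),
          (mfderiv (𝓡 n) (𝓡 (n + 1)) ψ w u : EuclideanSpace ℝ (Fin (n + 1))) = v := by
      rintro _ rfl v
      rw [← (hψ w hw.1).2]
      exact Iff.rfl
    exact h _ (hinv w hw)
  have hint' : ∀ᶠ w in 𝓝 (0 : EuclideanSpace ℝ (Fin n)), ∀ u,
      θ (Fin.last n) (Ψ w) (fderiv ℝ Ψ w u) = 0 := by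
    filter_upwards [hW'.mem_nhds h0'] with w hw u
    rw [he.dual_last_eq_zero_iff hθ (hdom w hw), hmem w hw]
    exact ⟨u, hmf w hw u⟩
  have hX : ∀ k : Fin n, ∃ u, fderiv ℝ Ψ 0 u = coordField p (e k.castSucc) (Ψ 0) := by
    intro k
    have h1 := he.horizontal k _ (hdom 0 h0').2
    rw [← coordDeriv_coordField (hdom 0 h0').1 (e k.castSucc)] at h1
    obtain ⟨u, hu⟩ := (hmem 0 h0' _).1 h1
    exact ⟨u, (isInvertible_coordDeriv (hdom 0 h0').1).injective ((hmf 0 h0' u).symm.trans hu)⟩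
  obtain ⟨u, hu⟩ := hX i
  obtain ⟨v, hv⟩ := hX j
  have hsymm := fderiv_symm_of_integral ((hΨs 0 h0').of_le (WithTop.coe_le_coe.2 le_top))
    (hθ.differentiableAt_dual (hdom 0 h0') (Fin.last n)) hint' u v
  have hbr := he.dual_last_lieBracket hU hd hθ (hdom 0 h0') i j
  have hb := hθ.dual_lieBracket (hdom 0 h0') (Fin.last n) i.castSucc j.castSucc
  rw [hu, hv] at hsymm
  rw [hbr, hsymm, sub_self, hinv 0 h0', hψ0] at hb
  linarith

/-- Vanishing f make the ε_i commute; in the resulting chart they are the standard basis fields, and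
a linear map between orthonormal frames preserves inner products. -/
theorem isLocallyFlatOn (he : IsAdaptedFrame φ U e ε) (hφU : IsOpen (φ '' U))
    (hd : IsIntegrabilityData φ U e ε f κ σ) (hf : ∀ i j k, ∀ x ∈ U, f i j k x = 0) :
    IsLocallyFlatOn n (φ '' U) := by
  have hbr : ∀ i j, ∀ y ∈ φ '' U, mlieBracket (𝓡 n) (ε i) (ε j) y = 0 := by
    obtain ⟨F, -, hF, hfF⟩ := hd.base
    rintro i j _ ⟨x, hx, rfl⟩
    rw [hF i j _ (mem_image_of_mem φ hx)]
    exact Finset.sum_eq_zero fun k _ ↦ by rw [← hfF i j k x hx, hf i j k x hx, zero_smul]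
  intro q hq
  obtain ⟨η, hη⟩ := he.exists_isDualFrame_base hφU q
  obtain ⟨χ, hqχ, hχD, hχs, hχs', hχ⟩ := hη.exists_chart (fun y hy i j ↦ by
    rw [← coordField_mlieBracket hφU (he.smooth_base i) (he.smooth_base j) hy]
    refine coordField_eq_of_coordDeriv hy.1 ?_
    rw [map_zero, hbr i j _ hy.2]) (mem_coordDomain hq)
  have hχt : χ.source ⊆ (extChartAt (𝓡 n) q).target := fun y hy ↦ (hχD hy).1
  let ψ : PartialDiffeomorph (𝓡 n) (𝓡 n) N (EuclideanSpace ℝ (Fin n)) ∞ :=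
    { toPartialEquiv := (extChartAt (𝓡 n) q).trans χ.toPartialEquiv
      open_source := isOpen_extChartAt_preimage' q χ.open_source
      open_target := χ.symm.isOpen_inter_preimage (isOpen_extChartAt_target q)
      contMDiffOn_toFun := hχs.contMDiffOn.comp ((contMDiffOn_extChartAt).mono
        fun x hx ↦ by simpa using hx.1) fun x hx ↦ hx.2
      contMDiffOn_invFun := (contMDiffOn_extChartAt_symm q).comp
        (hχs'.contMDiffOn.mono inter_subset_left) fun x hx ↦ hx.2 }
  refine ⟨ψ, ⟨mem_extChartAt_source q, hqχ⟩, fun x hx ↦ ?_, fun x hx ↦ ?_⟩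
  · have hx2 : extChartAt (𝓡 n) q x ∈ χ.source := hx.2
    have h := (hχD hx2).2
    rwa [mem_preimage, (extChartAt (𝓡 n) q).left_inv hx.1] at h
  have hx2 : extChartAt (𝓡 n) q x ∈ χ.source := hx.2
  have hxU : x ∈ φ '' U := by
    have h := (hχD hx2).2
    rwa [mem_preimage, (extChartAt (𝓡 n) q).left_inv hx.1] at h
  have hframe : ∀ y ∈ χ.source, ∀ i,
      (mfderiv (𝓡 n) (𝓡 n) ψ ((extChartAt (𝓡 n) q).symm y) (ε i ((extChartAt (𝓡 n) q).symm y)) :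
        EuclideanSpace ℝ (Fin n)) = EuclideanSpace.single i 1 := by
    intro y hy i
    have hψy : MDifferentiableAt (𝓡 n) (𝓡 n) ψ ((extChartAt (𝓡 n) q).symm y) :=
      ψ.mdifferentiableAt (by simp) ⟨(extChartAt (𝓡 n) q).map_target (hχt hy), by
        change extChartAt (𝓡 n) q ((extChartAt (𝓡 n) q).symm y) ∈ χ.source
        rw [(extChartAt (𝓡 n) q).right_inv (hχt hy)]
        exact hy⟩
    have hev : ψ ∘ (extChartAt (𝓡 n) q).symm =ᶠ[𝓝 y] χ := by
      filter_upwards [χ.open_source.mem_nhds hy] with z hz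
      change χ (extChartAt (𝓡 n) q ((extChartAt (𝓡 n) q).symm z)) = χ z
      rw [(extChartAt (𝓡 n) q).right_inv (hχt hz)]
    have h1 := mfderiv_comp y hψy
      ((contMDiffAt_extChartAt_symm (hχt hy)).mdifferentiableAt (by simp))
    rw [hev.mfderiv_eq (I := 𝓡 n) (I' := 𝓡 n), mfderiv_eq_fderiv] at h1
    rw [← coordDeriv_coordField (hχt hy) (ε i), ← hχ y hy i, h1]
    rfl
  have hframe' := hframe _ hx2
  rw [(extChartAt (𝓡 n) q).left_inv hx.1] at hframe'
  have := finiteDimensional_tangentSpace (m := n) x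
  intro u v
  refine inner_map_map_of_orthonormal (he.orthonormal_base x hxU)
    (by rw [finrank_tangentSpace]; simp) (F' := EuclideanSpace ℝ (Fin n))
    (T := (mfderiv (𝓡 n) (𝓡 n) ψ x).toLinearMap) ?_ u v
  have hon : Orthonormal ℝ fun i : Fin n ↦ (EuclideanSpace.single i 1 : EuclideanSpace ℝ (Fin n)) :=
    EuclideanSpace.orthonormal_single
  exact (funext hframe' : (fun i ↦ (mfderiv (𝓡 n) (𝓡 n) ψ x (ε i x) :
    EuclideanSpace ℝ (Fin n))) = _) ▸ hon

end IsAdaptedFrame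

end IntegrabilityData

end RiemSubm

end

theorem mainTheorem1 {n : ℕ}
    {M : Type*} [TopologicalSpace M] [T2Space M] [SecondCountableTopology M]
    [ChartedSpace (EuclideanSpace ℝ (Fin (n + 1))) M] [IsManifold (𝓡 (n + 1)) ∞ M]
    [RiemannianBundle (fun x : M ↦ TangentSpace (𝓡 (n + 1)) x)]
    [IsContMDiffRiemannianBundle (𝓡 (n + 1)) ∞ (EuclideanSpace ℝ (Fin (n + 1)))
      (fun x : M ↦ TangentSpace (𝓡 (n + 1)) x)]
    {N : Type*} [TopologicalSpace N] [T2Space N] [SecondCountableTopology N]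
    [ChartedSpace (EuclideanSpace ℝ (Fin n)) N] [IsManifold (𝓡 n) ∞ N]
    [RiemannianBundle (fun y : N ↦ TangentSpace (𝓡 n) y)]
    [IsContMDiffRiemannianBundle (𝓡 n) ∞ (EuclideanSpace ℝ (Fin n))
      (fun y : N ↦ TangentSpace (𝓡 n) y)]
    (φ : M → N) (hφ : RiemSubm.IsRiemannianSubmersion (n + 1) n φ)
    (U : Set M) (hU : IsOpen U)
    (e : Fin (n + 1) → (x : M) → TangentSpace (𝓡 (n + 1)) x)
    (ε : Fin n → (y : N) → TangentSpace (𝓡 n) y)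
    (he : RiemSubm.IsAdaptedFrame φ U e ε) :
    (∃ f κ σ, RiemSubm.IsIntegrabilityData φ U e ε f κ σ) ∧
    ∀ (f : Fin n → Fin n → Fin n → M → ℝ) (κ : Fin n → M → ℝ) (σ : Fin n → Fin n → M → ℝ),
      RiemSubm.IsIntegrabilityData φ U e ε f κ σ →
      ((∀ i j k, ∀ x ∈ U, f i j k x = 0) → RiemSubm.IsLocallyFlatOn n (φ '' U)) ∧
      ((∀ i j, ∀ x ∈ U, σ i j x = 0) ↔
        RiemSubm.IsIntegrableOn n (RiemSubm.horizontalSpace (n + 1) n φ) U) ∧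
      ((∀ i, ∀ x ∈ U, κ i x = 0) ↔ RiemSubm.IsHarmonicOn (n + 1) n φ U) := by
  -- Openness of φ(U) turns smoothness of ε on φ(U) into smoothness at points, as brackets and
  -- charts downstairs require.
  have hφU : IsOpen (φ '' U) :=
    RiemSubm.isOpenMap_of_surjective_mfderiv hφ.smooth hφ.surjective U hU
  exact ⟨he.exists_integrabilityData hφ.smooth hU hφU, fun f κ σ hd ↦
    ⟨he.isLocallyFlatOn hφU hd, ⟨he.isIntegrableOn_of_forall_eq_zero hφ.surjective hU hd,
      he.forall_eq_zero_of_isIntegrableOn hU hd⟩, he.isHarmonicOn_iff hφ.smooth hU hφU hd⟩⟩
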